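/- Let $d\ge 1$ and $s\in(0,1)$, and let $\Omega\subset\mathbb{R}^d$ be a polytopal domain (a polygon if $d=2$), i.e. an open set with $\Omega=\operatorname{int}\overline{\Omega}$ whose closure is a finite union of simplices. Let $\{\mathcal P_h\}$ be a family of conforming simplicial triangulations of $\Omega$ with elements $K$ of diameter $h_K$ and mesh size $h=\max_{K\in\mathcal P_h}h_K$. Assume that the family is shape-regular (there is $\sigma$ with $h_K\le\sigma\rho_K$ for all $h$ and all $K\in\mathcal P_h$, where $\rho_K$ is the diameter of the largest ball inscribed in $K$) and globally quasi-uniform (there is $c>0$ with $c\,h\le h_K$ for all $h$ and all $K\in\mathcal P_h$). Let $\phi_i$ be the continuous piecewise linear nodal basis function of the node $z_i$ of $\mathcal P_h$, i.e. $\phi_i(z_j)=\delta_{ij}$, extended by zero outside $\overline\Omega$. The degrees of freedom are all nodes $z_i$ if $s<1/2$, and the nodes $z_i\notin\partial\Omega$ if $s\ge 1/2$. Let $\boldsymbol M=\left(\int_\Omega\phi_i\phi_j\right)_{i,j}$ be the mass matrix and $\boldsymbol A^s=\left(a(\phi_i,\phi_j)\right)_{i,j}$ the stiffness matrix of the integral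 fractional Laplacian, indexed by the degrees of freedom, where $$a(u,v)=\frac{C(d,s)}{2}\int_\Omega\int_\Omega\frac{(u(x)-u(y))(v(x)-v(y))}{|x-y|^{d+2s}}\,dy\,dx+C(d,s)\int_\Omega\int_{\Omega^c}\frac{u(x)v(x)}{|x-y|^{d+2s}}\,dy\,dx,\qquad C(d,s)=\frac{2^{2s}s\,\Gamma(s+d/2)}{\pi^{d/2}\Gamma(1-s)}.$$ Then there is a constant $C>0$, independent of $h$ and of $\Delta t$, such that for every triangulation $\mathcal P_h$ of the family and every time step $0<\Delta t\le 1$ $$\kappa\left(\boldsymbol M+\Delta t\,\boldsymbol A^s\right)\le C\left(1+\frac{\Delta t}{h^{2s}}\right),$$ where $\kappa(\boldsymbol B)=\|\boldsymbol B\|_2\,\|\boldsymbol B^{-1}\|_2$ is the spectral condition number ($\kappa(\boldsymbol B)=\infty$ if $\boldsymbol B$ is singular). -/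

import Mathlib

open MeasureTheory
open scoped ENNReal

noncomputable section

namespace FracLap

/-- Euclidean space `ℝ^d`. -/
abbrev E (d : ℕ) : Type := EuclideanSpace ℝ (Fin d)

/-- A conforming simplicial triangulation of (the closure of) the domain `Ω ⊆ ℝ^d`: a finite
simplicial complex whose underlying space is `closure Ω` and in which each simplex is a face of a
`d`-simplex. -/
structure Triangulation (d : ℕ) (Ω : Set (E d)) extends Geometry.SimplicialComplex ℝ (E d) where
  finite_faces : faces.Finite
  pure : ∀ s ∈ faces, ∃ t ∈ faces, s ⊆ t ∧ t.card = d + 1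
  space_eq : toSimplicialComplex.space = closure Ω

namespace Triangulation

variable {d : ℕ} {Ω : Set (E d)}

/-- The elements `K` of the mesh, as closed subsets of `ℝ^d`. -/
def elements (T : Triangulation d Ω) : Set (Set (E d)) :=
  {K | ∃ t ∈ T.faces, t.card = d + 1 ∧ K = convexHull ℝ (t : Set (E d))}

/-- The mesh size `h`, the maximum of the diameters `h_K` of the (finitely many) elements `K`. -/
def meshSize (T : Triangulation d Ω) : ℝ :=
  sSup (Metric.diam '' T.elements)

/-- `w` is a family of barycentric coordinates of the point `x` in the simplex with vertex
set `t`. -/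
def IsBarycentric (t : Finset (E d)) (w : E d → ℝ) (x : E d) : Prop :=
  (∀ y ∈ t, 0 ≤ w y) ∧ ∑ y ∈ t, w y = 1 ∧ ∑ y ∈ t, w y • y = x

open scoped Classical in
/-- The piecewise linear basis function (hat function) `φ_z` of the node `z`: on a simplex of the
mesh having `z` as a vertex, the barycentric coordinate with respect to `z`; zero elsewhere. -/
def hat (T : Triangulation d Ω) (z x : E d) : ℝ :=
  if h : ∃ p : Finset (E d) × (E d → ℝ), p.1 ∈ T.faces ∧ z ∈ p.1 ∧ IsBarycentric p.1 p.2 x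
  then (Classical.choose h).2 z
  else 0

/-- The degrees of freedom: all nodes of the mesh if `s < 1/2`, the nodes not on the boundary
of `Ω` if `s ≥ 1/2`. -/
def dofs (T : Triangulation d Ω) (s : ℝ) : Set (E d) :=
  {z | z ∈ T.vertices ∧ (1 / 2 ≤ s → z ∉ frontier Ω)}

theorem finite_dofs (T : Triangulation d Ω) (s : ℝ) : (T.dofs s).Finite := by
  have h : (T.vertices).Finite :=
    T.finite_faces.preimage (f := fun x : E d => ({x} : Finset (E d)))
      (fun a _ b _ hab => Finset.singleton_injective hab)
  exact h.subset fun z hz => hz.1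

instance (T : Triangulation d Ω) (s : ℝ) : Fintype (T.dofs s) := (T.finite_dofs s).fintype

theorem IsBarycentric.eq_of_indep {t : Finset (E d)} {v w : E d → ℝ} {x : E d}
    (ht : AffineIndependent ℝ ((↑) : t → E d)) (hv : IsBarycentric t v x)
    (hw : IsBarycentric t w x) {z : E d} (hz : z ∈ t) : v z = w z := by
  rw [affineIndependent_iff] at ht
  have h := ht Finset.univ (fun y => v y - w y) ?_ ?_ ⟨z, hz⟩ (Finset.mem_univ _)
  · simpa [sub_eq_zero] using h
  · rw [Finset.univ_eq_attach, Finset.sum_attach t (fun y => v y - w y),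
      Finset.sum_sub_distrib, hv.2.1, hw.2.1, sub_self]
  · rw [Finset.univ_eq_attach, Finset.sum_attach t (fun y => (v y - w y) • y)]
    simp only [sub_smul]
    rw [Finset.sum_sub_distrib, hv.2.2, hw.2.2, sub_self]

/-- The value of `φ_z` does not depend on the simplex in which it is computed. -/
theorem hat_eq (T : Triangulation d Ω) {z x : E d} {t : Finset (E d)} {w : E d → ℝ}
    (ht : t ∈ T.faces) (hz : z ∈ t) (hw : IsBarycentric t w x) : T.hat z x = w z := by
  classical
  have h : ∃ p : Finset (E d) × (E d → ℝ),
      p.1 ∈ T.faces ∧ z ∈ p.1 ∧ IsBarycentric p.1 p.2 x := ⟨(t, w), ht, hz, hw⟩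
  obtain ⟨hp1, hp2, hp3⟩ := Classical.choose_spec h
  rw [hat, dif_pos h]
  generalize Classical.choose h = p at hp1 hp2 hp3
  have hx : x ∈ convexHull ℝ ((t ∩ p.1 : Finset (E d)) : Set (E d)) := by
    rw [Finset.coe_inter]
    exact T.inter_subset_convexHull ht hp1
      ⟨Finset.mem_convexHull'.2 ⟨w, hw⟩, Finset.mem_convexHull'.2 ⟨p.2, hp3⟩⟩
  obtain ⟨v, hv⟩ := Finset.mem_convexHull'.1 hx
  have ext : ∀ r : Finset (E d), t ∩ p.1 ⊆ r →
      IsBarycentric r (fun y => if y ∈ t ∩ p.1 then v y else 0) x := by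
    intro r hr
    refine ⟨fun y _ => ?_, ?_, ?_⟩
    · dsimp only
      split_ifs with hy
      · exact hv.1 y hy
      · exact le_rfl
    · rw [← hv.2.1, ← Finset.sum_subset hr (fun y _ hy => if_neg hy)]
      exact Finset.sum_congr rfl fun y hy => if_pos hy
    · rw [← hv.2.2, ← Finset.sum_subset hr (fun y _ hy => by simp only [if_neg hy, zero_smul])]
      exact Finset.sum_congr rfl fun y hy => by simp only [if_pos hy]
  rw [IsBarycentric.eq_of_indep (T.indep hp1) hp3 (ext _ Finset.inter_subset_right) hp2,
    IsBarycentric.eq_of_indep (T.indep ht) hw (ext _ Finset.inter_subset_left) hz]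

/-- `φ_z` takes the value `1` at `z` and `0` at each other node. -/
theorem hat_node (T : Triangulation d Ω) {z y : E d} (hz : z ∈ T.vertices)
    (hy : y ∈ T.vertices) [Decidable (z = y)] : T.hat z y = if z = y then 1 else 0 := by
  classical
  by_cases hzy : z = y
  · subst hzy
    rw [T.hat_eq (t := {z}) (w := fun _ => 1) hz (by simp) (by simp [IsBarycentric])]
    simp
  · rw [if_neg hzy]
    by_cases h : ∃ p : Finset (E d) × (E d → ℝ),
        p.1 ∈ T.faces ∧ z ∈ p.1 ∧ IsBarycentric p.1 p.2 y
    · obtain ⟨⟨t, w⟩, ht, hzt, hw⟩ := h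
      have hyt : y ∈ t := (T.vertex_mem_convexHull_iff hy ht).1
        (Finset.mem_convexHull'.2 ⟨w, hw⟩)
      have hd : IsBarycentric t (fun u => if u = y then 1 else 0) y := by
        refine ⟨fun u _ => ?_, ?_, ?_⟩
        · dsimp only
          split_ifs <;> norm_num
        · simp [hyt]
        · simp [hyt]
      rw [T.hat_eq ht hzt hd, if_neg hzy]
    · rw [hat, dif_neg h]

end Triangulation

/-- A family of triangulations is shape-regular: the ratio of the diameter `h_K` of an element `K`
to the diameter `2 r` of a ball inscribed in `K` is bounded uniformly over the family. -/
def ShapeRegular {d : ℕ} {Ω : Set (E d)} {ι : Type*} (P : ι → Triangulation d Ω) : Prop :=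
  ∃ σ : ℝ, ∀ i, ∀ K ∈ (P i).elements, ∃ (c : E d) (r : ℝ),
    0 < r ∧ Metric.closedBall c r ⊆ K ∧ Metric.diam K ≤ σ * (2 * r)

/-- A family of triangulations is globally quasi-uniform: the diameter of each element is
comparable to the mesh size, uniformly over the family. -/
def QuasiUniform {d : ℕ} {Ω : Set (E d)} {ι : Type*} (P : ι → Triangulation d Ω) : Prop :=
  ∃ c : ℝ, 0 < c ∧ ∀ i, ∀ K ∈ (P i).elements, c * (P i).meshSize ≤ Metric.diam K

/-- The normalisation constant `C(d,s)` of the fractional Laplacian. -/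
def fracConst (d : ℕ) (s : ℝ) : ℝ :=
  2 ^ (2 * s) * s * Real.Gamma (s + d / 2) / (Real.pi ^ ((d : ℝ) / 2) * Real.Gamma (1 - s))

/-- The bilinear form `a(u,v)` of the integral fractional Laplacian on `Ω`, for functions `u`, `v`
that vanish outside `Ω`. -/
def fracForm {d : ℕ} (Ω : Set (E d)) (s : ℝ) (u v : E d → ℝ) : ℝ :=
  fracConst d s / 2 *
      (∫ x in Ω, ∫ y in Ω, (u x - u y) * (v x - v y) / ‖x - y‖ ^ ((d : ℝ) + 2 * s)) +
    fracConst d s *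
      (∫ x in Ω, ∫ y in Ωᶜ, u x * v x / ‖x - y‖ ^ ((d : ℝ) + 2 * s))

/-- The stiffness matrix `A^s` of the fractional Laplacian. -/
def stiffnessMatrix {d : ℕ} {Ω : Set (E d)} (T : Triangulation d Ω) (s : ℝ) :
    Matrix (T.dofs s) (T.dofs s) ℝ :=
  Matrix.of fun i j => fracForm Ω s (T.hat i) (T.hat j)

/-- The mass matrix `M` on the same degrees of freedom. -/
def massMatrix {d : ℕ} {Ω : Set (E d)} (T : Triangulation d Ω) (s : ℝ) :
    Matrix (T.dofs s) (T.dofs s) ℝ :=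
  Matrix.of fun i j => ∫ x in Ω, T.hat i x * T.hat j x

open scoped Classical in
/-- The spectral condition number `κ(B) = ‖B‖₂ ‖B⁻¹‖₂` of a square matrix, with the usual
convention `κ(B) = ∞` for singular `B`. -/
def condNumber {n : Type*} [Fintype n] (B : Matrix n n ℝ) : ℝ≥0∞ :=
  if IsUnit B then
    ENNReal.ofReal (‖Matrix.toEuclideanCLM (n := n) (𝕜 := ℝ) B‖ *
      ‖Matrix.toEuclideanCLM (n := n) (𝕜 := ℝ) B⁻¹‖)
  else ⊤

end FracLap

end

/-!
Both matrices of the system are Gram matrices, so that the condition number is estimated through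
the Rayleigh quotient of `M + Δt A^s` (`condNumber_le`). Three bounds for a mesh of size `h` are
needed: `c h^d ≤ M ≤ C h^d` (`exists_mass_bounds`) and `0 ≤ A^s ≤ C h^{d-2s}`
(`exists_stiffness_bounds`), in the sense of quadratic forms. Together they give
`κ ≤ (C h^d + C Δt h^{d-2s}) / (c h^d)`. By shape-regularity and quasi-uniformity all elements
contain a ball of radius `ρ h` with a fixed `ρ` (`exists_inscribed_balls`), and this is the only
way in which the two assumptions enter.

*Upper bounds.* At most `d + 1` hat functions are nonzero at each point. The Cauchy–Schwarz
inequality applied to the integrand therefore bounds a Gram matrix of hat functions, or of their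
increments `φ(x) - φ(y)`, by a multiple of its diagonal (`dotProduct_gram_le`), even though `A^s`
is a full matrix. It remains to bound the energy of one hat function by `C h^{d-2s}`
(`exists_energy_majorant`).
* For `s ≥ 1/2` the node `z` lies in `Ω`. Its open star is then open in `ℝ^d`
  (`isOpen_hat_pos`), so that `φ_z` vanishes off `Ω` and is globally Lipschitz with a constant of
  order `1/h` (`abs_hat_sub_le`). The numerator of the energy density is at most
  `min(1, (|x-y|/R)^2)` with `R` of order `h`, and polar coordinates and scaling give the bound
  (`exists_lintegral_dampedKernel_le`).
* For `s < 1/2` the hat function of a boundary node jumps across the boundary. It is Lipschitz on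
  each element `K`, which takes care of pairs of points in the same element. The other pairs
  contribute at most the fractional perimeter `∫_K ∫_{Kᶜ} |x-y|^{-d-2s}`, which for a convex set
  `K` is `O(h^{-2s} |K|)` (`lintegral_perimeter_le`). Elements have disjoint interiors, so the
  volumes `|K|` of those at `z` add up to `O(h^d)`.

*Lower bound.* On an element, a finite element function is at least half its largest nodal value
on the copy of the element shrunk by `1/4` towards the corresponding vertex (`nodal_sq_le`). Hence
its square integral there dominates `h^d` times the sum of the squared nodal values
(`sum_nodal_sq_le`), and summation over the elements gives `c h^d ≤ M`.
-/

noncomputable section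

namespace FracLap

/-! ### Condition numbers of positive definite matrices -/

section LinearAlgebra

open Matrix

variable {n : Type*} [Fintype n]

/-- The Cauchy–Schwarz inequality for a positive semidefinite symmetric bilinear form. -/
theorem dotProduct_mulVec_sq_le {B : Matrix n n ℝ} (hB : B.IsSymm)
    (hpos : ∀ v : n → ℝ, 0 ≤ v ⬝ᵥ B *ᵥ v) (v w : n → ℝ) :
    (v ⬝ᵥ B *ᵥ w) ^ 2 ≤ (v ⬝ᵥ B *ᵥ v) * (w ⬝ᵥ B *ᵥ w) := by
  have hsymm : w ⬝ᵥ B *ᵥ v = v ⬝ᵥ B *ᵥ w := by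
    rw [dotProduct_mulVec, ← mulVec_transpose, hB.eq, dotProduct_comm]
  have key : ∀ t : ℝ, 0 ≤ (w ⬝ᵥ B *ᵥ w) * (t * t) + (2 * (v ⬝ᵥ B *ᵥ w)) * t
      + v ⬝ᵥ B *ᵥ v := by
    intro t
    have h := hpos (v + t • w)
    simp only [mulVec_add, mulVec_smul, add_dotProduct, dotProduct_add, smul_dotProduct,
      dotProduct_smul, smul_eq_mul, hsymm] at h
    linarith
  have h := discrim_le_zero key
  rw [discrim] at h
  nlinarith

theorem isUnit_of_coercive [DecidableEq n] {B : Matrix n n ℝ} {a : ℝ} (ha : 0 < a)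
    (h : ∀ v : n → ℝ, a * (v ⬝ᵥ v) ≤ v ⬝ᵥ B *ᵥ v) : IsUnit B := by
  rw [← Matrix.mulVec_injective_iff_isUnit]
  refine (injective_iff_map_eq_zero B.mulVecLin).2 fun v hv => ?_
  have h1 := h v
  rw [show B *ᵥ v = 0 from hv, dotProduct_zero] at h1
  have h2 : v ⬝ᵥ v = 0 :=
    le_antisymm (by nlinarith) (Finset.sum_nonneg fun i _ => mul_self_nonneg _)
  exact dotProduct_self_eq_zero.1 h2

theorem inner_eq_dotProduct (x y : EuclideanSpace ℝ n) :
    inner ℝ x y = x.ofLp ⬝ᵥ y.ofLp := by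
  rw [EuclideanSpace.inner_eq_star_dotProduct, dotProduct_comm]
  simp

theorem dotProduct_self_eq_norm_sq (x : EuclideanSpace ℝ n) :
    x.ofLp ⬝ᵥ x.ofLp = ‖x‖ ^ 2 := by
  rw [← inner_eq_dotProduct, real_inner_self_eq_norm_sq]

/-- Two-sided bounds on the Rayleigh quotient of a symmetric matrix bound its condition number. -/
theorem condNumber_le {B : Matrix n n ℝ} (hB : B.IsSymm) {a b : ℝ} (ha : 0 < a) (hb : 0 ≤ b)
    (hlow : ∀ v : n → ℝ, a * (v ⬝ᵥ v) ≤ v ⬝ᵥ B *ᵥ v)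
    (hup : ∀ v : n → ℝ, v ⬝ᵥ B *ᵥ v ≤ b * (v ⬝ᵥ v)) :
    condNumber B ≤ ENNReal.ofReal (b / a) := by
  classical
  have hsq : ∀ v : n → ℝ, 0 ≤ v ⬝ᵥ v := fun v =>
    Finset.sum_nonneg fun i _ => mul_self_nonneg _
  have hpos : ∀ v : n → ℝ, 0 ≤ v ⬝ᵥ B *ᵥ v := fun v =>
    (mul_nonneg ha.le (hsq v)).trans (hlow v)
  have hunit := isUnit_of_coercive ha hlow
  rw [condNumber, if_pos hunit]
  refine ENNReal.ofReal_le_ofReal ?_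
  rw [div_eq_mul_inv]
  refine mul_le_mul ?_ ?_ (norm_nonneg _) hb
  · refine ContinuousLinearMap.opNorm_le_bound _ hb fun x => ?_
    -- Cauchy–Schwarz for the form of `B`, applied to the vectors `B x` and `x`.
    have h1 := dotProduct_mulVec_sq_le hB hpos (B *ᵥ x.ofLp) x.ofLp
    have h2 := mul_le_mul (hup (B *ᵥ x.ofLp)) (hup x.ofLp) (hpos _) (mul_nonneg hb (hsq _))
    have h3 : (B *ᵥ x.ofLp) = (Matrix.toEuclideanCLM (n := n) (𝕜 := ℝ) B x).ofLp :=
      (Matrix.ofLp_toEuclideanCLM B x).symm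
    rw [h3] at h1 h2
    rw [dotProduct_self_eq_norm_sq] at h1 h2
    rw [dotProduct_self_eq_norm_sq] at h2
    set N := ‖(Matrix.toEuclideanCLM (n := n) (𝕜 := ℝ)) B x‖
    have hN : 0 ≤ N := norm_nonneg _
    rcases hN.eq_or_lt with h0 | h0
    · rw [← h0]; positivity
    · have h4 : N ^ 2 * N ^ 2 ≤ N ^ 2 * (b * ‖x‖) ^ 2 := by nlinarith
      have h5 := le_of_mul_le_mul_left h4 (by positivity)
      exact le_of_sq_le_sq h5 (by positivity)
  · refine ContinuousLinearMap.opNorm_le_bound _ (by positivity) fun x => ?_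
    set y := Matrix.toEuclideanCLM (n := n) (𝕜 := ℝ) B⁻¹ x with hy
    have hBy : B *ᵥ y.ofLp = x.ofLp := by
      rw [hy, Matrix.ofLp_toEuclideanCLM, Matrix.mulVec_mulVec,
        Matrix.mul_nonsing_inv _ ((Matrix.isUnit_iff_isUnit_det _).1 hunit), Matrix.one_mulVec]
    have h1 := hlow y.ofLp
    rw [hBy, dotProduct_self_eq_norm_sq, ← inner_eq_dotProduct] at h1
    have h2 := real_inner_le_norm y x
    rcases (norm_nonneg y).eq_or_lt with h0 | h0
    · rw [← h0]; positivity
    · rw [inv_mul_eq_div, le_div_iff₀ ha]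
      have : ‖y‖ * (‖y‖ * a) ≤ ‖y‖ * ‖x‖ := by nlinarith
      exact le_of_mul_le_mul_left this h0

end LinearAlgebra

/-! ### Truncated singular kernels -/

/-- The kernel `|w|^{-(d+2s)}`, damped by the factor `min(1, (|w|/R)^p)` near the origin. -/
def dampedKernel (d : ℕ) (s : ℝ) (p : ℕ) (R : ℝ) (w : E d) : ℝ :=
  min 1 ((‖w‖ / R) ^ p) / ‖w‖ ^ ((d : ℝ) + 2 * s)

variable {d : ℕ} {s : ℝ} {p : ℕ}

theorem dampedKernel_nonneg {R : ℝ} (hR : 0 < R) (w : E d) : 0 ≤ dampedKernel d s p R w := by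
  unfold dampedKernel; positivity

theorem measurable_dampedKernel (R : ℝ) : Measurable (dampedKernel d s p R) := by
  unfold dampedKernel; fun_prop

theorem integrable_dampedKernel_one (hd : 1 ≤ d) (hs : 0 < s) (hp : 2 * s < p) :
    Integrable (dampedKernel d s p 1) := by
  have hne : Nontrivial (E d) := by
    have : Nonempty (Fin d) := ⟨⟨0, hd⟩⟩
    infer_instance
  have hfr : Module.finrank ℝ (E d) = d := by simp
  have h := integrable_fun_norm_addHaar (volume : Measure (E d))
    (f := fun r : ℝ => min 1 ((r / 1) ^ p) / r ^ ((d : ℝ) + 2 * s))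
  refine h.2 ?_
  rw [hfr]
  have hmeas : Measurable fun r : ℝ =>
      r ^ (d - 1) • (min 1 ((r / 1) ^ p) / r ^ ((d : ℝ) + 2 * s)) := by fun_prop
  have hpow : ∀ r : ℝ, 0 < r → r ^ (d - 1) / r ^ ((d : ℝ) + 2 * s) = r ^ (-1 - 2 * s) := by
    intro r hr
    rw [← Real.rpow_natCast, ← Real.rpow_sub hr, Nat.cast_sub hd]
    congr 1; push_cast; ring
  rw [← Set.Ioo_union_Ici_eq_Ioi (zero_lt_one), integrableOn_union]
  constructor
  · have hi : IntegrableOn (fun r : ℝ => r ^ ((p : ℝ) - 1 - 2 * s)) (Set.Ioo 0 1) := by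
      rw [intervalIntegral.integrableOn_Ioo_rpow_iff zero_lt_one]; linarith
    refine Integrable.mono' hi hmeas.aestronglyMeasurable ?_
    filter_upwards [ae_restrict_mem measurableSet_Ioo] with r hr
    have hr0 := hr.1
    rw [Real.norm_of_nonneg (by positivity), smul_eq_mul, ← mul_div_assoc, mul_comm, mul_div_assoc,
      hpow r hr0, show (p : ℝ) - 1 - 2 * s = p + (-1 - 2 * s) by ring, Real.rpow_add hr0,
      Real.rpow_natCast, div_one]
    gcongr
    exact min_le_right _ _
  · rw [integrableOn_Ici_iff_integrableOn_Ioi]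
    have hi := integrableOn_Ioi_rpow_of_lt (a := -1 - 2 * s) (by linarith) zero_lt_one
    refine Integrable.mono' hi hmeas.aestronglyMeasurable ?_
    filter_upwards [ae_restrict_mem measurableSet_Ioi] with r hr
    have hr0 : 0 < r := zero_lt_one.trans hr
    rw [Real.norm_of_nonneg (by positivity), smul_eq_mul, ← mul_div_assoc, mul_comm, mul_div_assoc,
      hpow r hr0]
    exact mul_le_of_le_one_left (by positivity) (min_le_left _ _)

/-- The damped kernel of range `R` has integral `R^{-2s}` times that of range `1`. -/
theorem exists_lintegral_dampedKernel_le (hd : 1 ≤ d) (hs : 0 < s) (hp : 2 * s < p) :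
    ∃ J : ℝ, 0 < J ∧ ∀ R : ℝ, 0 < R →
      ∫⁻ w : E d, ENNReal.ofReal (dampedKernel d s p R w) ≤
        ENNReal.ofReal (J * R ^ (-(2 * s))) := by
  have hint := integrable_dampedKernel_one hd hs hp
  have hJ : 0 ≤ ∫ w : E d, dampedKernel d s p 1 w :=
    integral_nonneg fun w => dampedKernel_nonneg one_pos w
  refine ⟨(∫ w : E d, dampedKernel d s p 1 w) + 1, by positivity, fun R hR => ?_⟩
  have hscale : dampedKernel d s p R =
      fun w => R ^ (-((d : ℝ) + 2 * s)) * dampedKernel d s p 1 (R⁻¹ • w) := by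
    ext w
    simp only [dampedKernel, norm_smul, norm_inv, Real.norm_of_nonneg hR.le, div_one]
    rw [Real.mul_rpow (by positivity) (norm_nonneg _), Real.inv_rpow hR.le,
      Real.rpow_neg hR.le, div_eq_inv_mul ‖w‖ R]
    have : R ^ ((d : ℝ) + 2 * s) ≠ 0 := (Real.rpow_pos_of_pos hR _).ne'
    rw [← mul_div_assoc, mul_div_mul_left _ _ (inv_ne_zero this)]
  have hintR : Integrable (dampedKernel d s p R) := by
    rw [hscale]
    exact (hint.comp_smul (inv_ne_zero hR.ne')).const_mul _
  rw [← ofReal_integral_eq_lintegral_ofReal hintR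
    (Filter.Eventually.of_forall fun w => dampedKernel_nonneg hR w)]
  refine ENNReal.ofReal_le_ofReal ?_
  rw [hscale, integral_const_mul, Measure.integral_comp_smul_of_nonneg _ _ _ (hR := by positivity)]
  have hfr : Module.finrank ℝ (E d) = d := by simp
  rw [hfr, inv_pow, inv_inv, smul_eq_mul, ← mul_assoc, ← Real.rpow_natCast, ← Real.rpow_add hR,
    mul_comm]
  rw [show -((d : ℝ) + 2 * s) + d = -(2 * s) by ring]
  gcongr
  linarith

/-- Integrating a translation invariant kernel against a set in the first variable. -/
theorem lintegral_indicator_mul_sub (g : E d → ℝ≥0∞) (hg : Measurable g) {S : Set (E d)}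
    (hS : MeasurableSet S) :
    ∫⁻ x, ∫⁻ y, S.indicator 1 x * g (x - y) = volume S * ∫⁻ w, g w := by
  have h : ∀ x, ∫⁻ y, S.indicator 1 x * g (x - y) = S.indicator 1 x * ∫⁻ w, g w := by
    intro x
    rw [lintegral_const_mul _ (by fun_prop), lintegral_sub_left_eq_self g x]
  simp_rw [h]
  rw [lintegral_mul_const _ (measurable_one.indicator hS), lintegral_indicator_one hS]

/-! ### The fractional perimeter of convex sets -/

/-- If the convex set `K` contains a ball of radius `r`, then the translate of its interior by `w`
misses only a portion `O(|w|/r)` of `K`: it contains the copy of `K` shrunk by the factor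
`1 - 2|w|/r` about the centre of the ball. -/
theorem volume_inter_translate_le {K : Set (E d)} (hK : Convex ℝ K)
    (hfin : volume K ≠ ∞) {c : E d} {r : ℝ} (hr : 0 < r)
    (hball : Metric.closedBall c r ⊆ K) {w : E d} (hw : w ≠ 0) :
    volume (K ∩ {x | x - w ∉ interior K}) ≤
      ENNReal.ofReal (min 1 (‖w‖ / (r / (2 * d)))) * volume K := by
  rcases le_or_gt 1 (‖w‖ / (r / (2 * d))) with h1 | h1
  · rw [min_eq_left h1, ENNReal.ofReal_one, one_mul]
    exact measure_mono Set.inter_subset_left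
  rw [min_eq_right h1.le]
  rcases Nat.eq_zero_or_pos d with rfl | hd
  · exact absurd (Subsingleton.elim w 0) hw
  have hd1 : (1 : ℝ) ≤ d := by exact_mod_cast hd
  -- `K` shrunk by `1 - t` keeps at least the distance `t r = 2‖w‖` from the complement of `K`.
  set t : ℝ := 2 * ‖w‖ / r with ht
  have ht0 : 0 < t := by have := norm_pos_iff.2 hw; positivity
  have hdt : ‖w‖ / (r / (2 * d)) = d * t := by rw [ht]; field_simp
  rw [hdt] at h1 ⊢
  have ht1 : t < 1 := by nlinarith
  have hfr : Module.finrank ℝ (E d) = d := by simp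
  set Kt := AffineMap.homothety c (1 - t) '' K with hKt
  have hcK : c ∈ K := hball (Metric.mem_closedBall_self hr.le)
  have hhom : ∀ x : E d, AffineMap.homothety c (1 - t) x = (1 - t) • x + t • c := by
    intro x
    rw [AffineMap.homothety_apply, vsub_eq_sub, vadd_eq_add]; module
  have hvol : volume Kt = ENNReal.ofReal ((1 - t) ^ d) * volume K := by
    rw [hKt, Measure.addHaar_image_homothety, hfr, abs_of_nonneg (by
      have : 0 ≤ 1 - t := by linarith
      positivity)]
  have hsub : K ∩ {x | x - w ∉ interior K} ⊆ K \ Kt := by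
    rintro x ⟨hxK, hx⟩
    refine ⟨hxK, ?_⟩
    rintro ⟨y, hy, rfl⟩
    refine hx ?_
    rw [hhom]
    have hq : c - t⁻¹ • w ∈ interior K := by
      refine interior_mono hball ?_
      rw [mem_interior_iff_mem_nhds]
      refine Metric.closedBall_mem_nhds_of_mem ?_
      rw [Metric.mem_ball, dist_eq_norm, sub_sub_cancel_left, norm_neg, norm_smul, norm_inv,
        Real.norm_of_nonneg ht0.le, ht]
      have := norm_pos_iff.2 hw
      field_simp
      linarith
    have := hK.combo_self_interior_mem_interior hy hq (by linarith : 0 ≤ 1 - t) ht0 (by ring)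
    convert this using 1
    rw [smul_sub, smul_smul, mul_inv_cancel₀ ht0.ne', one_smul]; abel
  have hKtK : Kt ⊆ K := by
    rintro _ ⟨y, hy, rfl⟩
    rw [hhom]
    exact hK hy hcK (by linarith) ht0.le (by ring)
  have hKtm : NullMeasurableSet Kt volume :=
    (hK.affine_image (AffineMap.homothety c (1 - t))).nullMeasurableSet volume
  refine (measure_mono hsub).trans ?_
  rw [measure_sdiff hKtK hKtm (ne_top_of_le_ne_top hfin (measure_mono hKtK)), hvol]
  rw [tsub_le_iff_right, ← add_mul, ← ENNReal.ofReal_add (by positivity)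
    (by have : 0 ≤ 1 - t := by linarith
        positivity)]
  refine le_mul_of_one_le_left zero_le ?_
  rw [← ENNReal.ofReal_one]
  refine ENNReal.ofReal_le_ofReal ?_
  have := one_add_mul_le_pow (a := -t) (by linarith) d
  rw [← sub_eq_add_neg] at this
  linarith

/-- The fractional perimeter of order `2s < 1` of a convex set is bounded by its volume and its
inradius. -/
theorem lintegral_perimeter_le {K : Set (E d)} (hK : Convex ℝ K) (hKm : MeasurableSet K)
    (hfin : volume K ≠ ∞) {c : E d} {r : ℝ} (hr : 0 < r) (hd : 1 ≤ d) (hs : 0 < s)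
    (hball : Metric.closedBall c r ⊆ K) :
    ∫⁻ x, ∫⁻ y, K.indicator 1 x * (interior K)ᶜ.indicator 1 y *
        ENNReal.ofReal (1 / ‖x - y‖ ^ ((d : ℝ) + 2 * s)) ≤
      volume K * ∫⁻ w : E d, ENNReal.ofReal (dampedKernel d s 1 (r / (2 * d)) w) := by
  have hUm : MeasurableSet (interior K)ᶜ := isOpen_interior.measurableSet.compl
  have hm1 : Measurable (K.indicator (1 : E d → ℝ≥0∞)) := measurable_one.indicator hKm
  have hm2 : Measurable ((interior K)ᶜ.indicator (1 : E d → ℝ≥0∞)) := measurable_one.indicator hUm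
  have h1 : ∀ x, ∫⁻ y, K.indicator 1 x * (interior K)ᶜ.indicator 1 y *
        ENNReal.ofReal (1 / ‖x - y‖ ^ ((d : ℝ) + 2 * s)) =
      ∫⁻ w, K.indicator 1 x * (interior K)ᶜ.indicator 1 (x - w) *
        ENNReal.ofReal (1 / ‖w‖ ^ ((d : ℝ) + 2 * s)) := by
    intro x
    rw [← lintegral_sub_left_eq_self _ x]
    simp
  simp_rw [h1]
  rw [lintegral_lintegral_swap]
  swap
  · refine Measurable.aemeasurable ?_
    unfold Function.uncurry
    dsimp only
    refine ((hm1.comp measurable_fst).mul (hm2.comp (by fun_prop))).mul ?_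
    fun_prop
  rw [← lintegral_const_mul _ (measurable_dampedKernel _).ennreal_ofReal]
  refine lintegral_mono fun w => ?_
  dsimp only
  rw [lintegral_mul_const]
  swap
  · exact hm1.mul (hm2.comp (by fun_prop))
  rcases eq_or_ne w 0 with rfl | hw
  -- The kernel has the value `1 / 0 = 0` at the origin.
  · have hne : (d : ℝ) + 2 * s ≠ 0 := by positivity
    simp [Real.zero_rpow hne]
  have h2 : ∫⁻ x, K.indicator 1 x * (interior K)ᶜ.indicator 1 (x - w) =
      volume (K ∩ {x | x - w ∉ interior K}) := by
    have hpre : MeasurableSet {x | x - w ∉ interior K} :=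
      hUm.preimage (measurable_id.sub_const w)
    rw [← lintegral_indicator_one (hKm.inter hpre)]
    refine lintegral_congr fun x => ?_
    by_cases hx : x ∈ K <;> by_cases hx' : x - w ∈ interior K <;> simp [hx, hx']
  rw [h2]
  refine (mul_le_mul_left (volume_inter_translate_le hK hfin hr hball hw) _).trans ?_
  rw [mul_comm _ (volume K), mul_assoc, ← ENNReal.ofReal_mul (by positivity), mul_one_div,
    dampedKernel, pow_one]

/-! ### Functions that are piecewise Lipschitz on a finite closed cover -/

/-- A real function on a normed space that is `L`-Lipschitz on each member of a finite closed
cover of the space is `L`-Lipschitz: the bound propagates along segments. -/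
theorem abs_sub_le_of_closed_cover {V κ : Type*} [NormedAddCommGroup V] [NormedSpace ℝ V]
    [Finite κ] (F : κ → Set V) (hF : ∀ k, IsClosed (F k)) (hcover : ∀ x, ∃ k, x ∈ F k)
    {f : V → ℝ} {L : ℝ} (hL : 0 ≤ L)
    (hlip : ∀ k, ∀ x ∈ F k, ∀ y ∈ F k, |f x - f y| ≤ L * ‖x - y‖) (x y : V) :
    |f x - f y| ≤ L * ‖x - y‖ := by
  have hcont : Continuous f := by
    refine (locallyFinite_of_finite F).continuous (by
      rw [Set.eq_univ_iff_forall]; simpa using hcover) hF fun k => ?_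
    refine LipschitzOnWith.continuousOn (K := L.toNNReal) ?_
    refine LipschitzOnWith.of_dist_le_mul fun a ha b hb => ?_
    rw [Real.coe_toNNReal _ hL, dist_eq_norm, dist_eq_norm, Real.norm_eq_abs]
    exact hlip k a ha b hb
  set γ : ℝ → V := fun t => x + t • (y - x) with hγ
  have hγc : Continuous γ := by fun_prop
  have hγd : ∀ a b, ‖γ a - γ b‖ = |a - b| * ‖x - y‖ := by
    intro a b
    have : γ a - γ b = (a - b) • (y - x) := by simp only [hγ]; module
    rw [this, norm_smul, Real.norm_eq_abs, norm_sub_rev]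
  set S : Set ℝ := {t | |f (γ t) - f (γ 0)| ≤ L * ‖x - y‖ * t}
  have hS : IsClosed S := isClosed_le (by fun_prop) (by fun_prop)
  have h1 : (1 : ℝ) ∈ S := by
    refine IsClosed.mem_of_ge_of_forall_exists_gt (a := (0 : ℝ)) (b := 1)
      (hS.inter isClosed_Icc) (by simp [S]) zero_le_one ?_
    rintro t ⟨htS, ht0, ht1⟩
    -- By finiteness, some member of the cover is visited at times accumulating at `t` from the
    -- right.
    have hfreq : ∃ k, ∃ᶠ u in nhdsWithin t (Set.Ioi t), γ u ∈ F k := by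
      by_contra hcon
      push Not at hcon
      have := (Filter.eventually_all.2 hcon).exists
      obtain ⟨u, hu⟩ := this
      obtain ⟨k, hk⟩ := hcover (γ u)
      exact hu k hk
    obtain ⟨k, hk⟩ := hfreq
    have htk : γ t ∈ F k := by
      refine (hF k).mem_of_frequently_of_tendsto hk ?_
      exact hγc.continuousAt.tendsto.mono_left nhdsWithin_le_nhds
    obtain ⟨u, hu, hut⟩ := (hk.and_eventually (Ioc_mem_nhdsGT ht1)).exists
    refine ⟨u, ?_, hut⟩
    have h2 := hlip k _ hu _ htk
    rw [hγd, abs_of_pos (sub_pos.2 hut.1)] at h2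
    have h3 := abs_sub_le (f (γ u)) (f (γ t)) (f (γ 0))
    have h4 : |f (γ t) - f (γ 0)| ≤ L * ‖x - y‖ * t := htS
    show |f (γ u) - f (γ 0)| ≤ L * ‖x - y‖ * u
    nlinarith
  have h2 : |f (γ 1) - f (γ 0)| ≤ L * ‖x - y‖ * 1 := h1
  have e1 : γ 1 = y := by simp [hγ]
  have e0 : γ 0 = x := by simp [hγ]
  rw [e1, e0, mul_one] at h2
  rwa [abs_sub_comm]

/-! ### Barycentric coordinates on simplices of full dimension -/

/-- `L` is the system of barycentric coordinate functions of the simplex with vertex set `t`,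
as affine functions on the whole space (`L z` is irrelevant for `z ∉ t`). -/
structure IsCoordSystem (t : Finset (E d)) (L : E d → E d →ᵃ[ℝ] ℝ) : Prop where
  sum_eq : ∀ x, ∑ z ∈ t, L z x = 1
  sum_smul : ∀ x, ∑ z ∈ t, L z x • z = x
  nonneg : ∀ x ∈ convexHull ℝ (t : Set (E d)), ∀ z ∈ t, 0 ≤ L z x

theorem exists_isCoordSystem {t : Finset (E d)} (ht : AffineIndependent ℝ ((↑) : t → E d))
    (hc : t.card = d + 1) : ∃ L, IsCoordSystem t L := by
  classical
  have htot : affineSpan ℝ (Set.range ((↑) : t → E d)) = ⊤ := by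
    rw [ht.affineSpan_eq_top_iff_card_eq_finrank_add_one]
    simp [hc]
  let b : AffineBasis t ℝ (E d) := ⟨(↑), ht, htot⟩
  have hb : ∀ i : t, b i = i := fun i => rfl
  refine ⟨fun z => if hz : z ∈ t then b.coord ⟨z, hz⟩ else 0, ?_, ?_, ?_⟩
  · intro x
    rw [← b.sum_coord_apply_eq_one x, Finset.univ_eq_attach, ← Finset.sum_attach]
    exact Finset.sum_congr rfl fun i _ => by simp
  · intro x
    conv_rhs => rw [← b.linear_combination_coord_eq_self x]
    rw [Finset.univ_eq_attach, ← Finset.sum_attach]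
    exact Finset.sum_congr rfl fun i _ => by simp [hb]
  · intro x hx z hz
    have hr : Set.range b = (t : Set (E d)) := by ext y; simp [hb]
    rw [← hr, b.convexHull_eq_nonneg_coord] at hx
    simpa [hz] using hx ⟨z, hz⟩

namespace IsCoordSystem

variable {t : Finset (E d)} {L : E d → E d →ᵃ[ℝ] ℝ}

theorem mem_convexHull_iff (hL : IsCoordSystem t L) {x : E d} :
    x ∈ convexHull ℝ (t : Set (E d)) ↔ ∀ z ∈ t, 0 ≤ L z x := by
  refine ⟨hL.nonneg x, fun h => ?_⟩
  exact Finset.mem_convexHull'.2 ⟨fun z => L z x, h, hL.sum_eq x, hL.sum_smul x⟩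

theorem isBarycentric (hL : IsCoordSystem t L) {x : E d}
    (hx : x ∈ convexHull ℝ (t : Set (E d))) :
    Triangulation.IsBarycentric t (fun z => L z x) x :=
  ⟨hL.nonneg x hx, hL.sum_eq x, hL.sum_smul x⟩

theorem le_one (hL : IsCoordSystem t L) {x : E d}
    (hx : x ∈ convexHull ℝ (t : Set (E d))) {z : E d} (hz : z ∈ t) : L z x ≤ 1 := by
  rw [← hL.sum_eq x]
  exact Finset.single_le_sum (f := fun z => L z x) (hL.nonneg x hx) hz

theorem apply_self (hL : IsCoordSystem t L) (ht : AffineIndependent ℝ ((↑) : t → E d))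
    {z y : E d} (hz : z ∈ t) (hy : y ∈ t) [Decidable (z = y)] :
    L z y = if z = y then 1 else 0 := by
  classical
  have hd : Triangulation.IsBarycentric t (fun u => if u = y then (1 : ℝ) else 0) y := by
    refine ⟨fun u _ => ?_, ?_, ?_⟩
    · dsimp only
      split_ifs <;> norm_num
    · simp [hy]
    · simp [hy]
  have := Triangulation.IsBarycentric.eq_of_indep ht
    (hL.isBarycentric (subset_convexHull ℝ _ hy)) hd hz
  rw [this]
  split_ifs <;> rfl

theorem continuous (z : E d) : Continuous (L z) := (L z).continuous_of_finiteDimensional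

/-- A barycentric coordinate takes values in `[0,1]` on an inscribed ball, hence has slope at most
the inverse of the diameter of that ball. -/
theorem abs_sub_le (hL : IsCoordSystem t L) {c : E d} {r : ℝ} (hr : 0 < r)
    (hball : Metric.closedBall c r ⊆ convexHull ℝ (t : Set (E d))) {z : E d} (hz : z ∈ t)
    (x y : E d) : |L z x - L z y| ≤ 1 / (2 * r) * ‖x - y‖ := by
  rcases eq_or_ne x y with rfl | hxy
  · simp
  have hn : 0 < ‖x - y‖ := norm_pos_iff.2 (sub_ne_zero.2 hxy)
  set u := (r / ‖x - y‖) • (x - y) with hu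
  have hun : ‖u‖ = r := by
    rw [hu, norm_smul, Real.norm_of_nonneg (by positivity), div_mul_cancel₀ _ hn.ne']
  have m1 : c + u ∈ convexHull ℝ (t : Set (E d)) := hball (by simp [hun])
  have m2 : c - u ∈ convexHull ℝ (t : Set (E d)) := hball (by simp [hun])
  have hlin : ∀ a b, L z a - L z b = (L z).linear (a - b) := fun a b => by
    rw [← vsub_eq_sub, ← vsub_eq_sub, AffineMap.linearMap_vsub]
  have h1 : |L z (c + u) - L z (c - u)| ≤ 1 := by
    rw [abs_le]
    have := hL.nonneg _ m1 z hz
    have := hL.nonneg _ m2 z hz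
    have := hL.le_one m1 hz
    have := hL.le_one m2 hz
    constructor <;> linarith
  have h2 : c + u - (c - u) = (2 * r / ‖x - y‖) • (x - y) := by
    rw [hu]; module
  rw [hlin, h2, map_smul, ← hlin, smul_eq_mul, abs_mul, abs_of_pos (by positivity)] at h1
  rw [div_mul_eq_mul_div, one_mul, le_div_iff₀ (by positivity)]
  rw [div_mul_eq_mul_div, div_le_one hn] at h1
  linarith

end IsCoordSystem

/-! ### Hat functions -/

namespace Triangulation

variable {Ω : Set (E d)} (T : Triangulation d Ω)

/-- The vertex sets of the elements of the mesh. -/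
def cells : Finset (Finset (E d)) :=
  T.finite_faces.toFinset.filter fun t => t.card = d + 1

variable {T}

theorem mem_cells {t : Finset (E d)} : t ∈ T.cells ↔ t ∈ T.faces ∧ t.card = d + 1 := by
  simp [cells]

theorem exists_coord {t : Finset (E d)} (ht : t ∈ T.cells) : ∃ L, IsCoordSystem t L :=
  exists_isCoordSystem (T.indep (mem_cells.1 ht).1) (mem_cells.1 ht).2

theorem hat_eq_coord {t : Finset (E d)} (ht : t ∈ T.cells) {L : E d → E d →ᵃ[ℝ] ℝ}
    (hL : IsCoordSystem t L) {z x : E d} (hz : z ∈ t)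
    (hx : x ∈ convexHull ℝ (t : Set (E d))) : T.hat z x = L z x :=
  T.hat_eq (mem_cells.1 ht).1 hz (hL.isBarycentric hx)

theorem exists_cell_of_hat_ne_zero {z x : E d} (h : T.hat z x ≠ 0) :
    ∃ t ∈ T.cells, z ∈ t ∧ x ∈ convexHull ℝ (t : Set (E d)) := by
  by_cases hp : ∃ p : Finset (E d) × (E d → ℝ), p.1 ∈ T.faces ∧ z ∈ p.1 ∧ IsBarycentric p.1 p.2 x
  · obtain ⟨p, h1, h2, h3⟩ := hp
    obtain ⟨t, ht, hpt, hc⟩ := T.pure p.1 h1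
    exact ⟨t, mem_cells.2 ⟨ht, hc⟩, hpt h2,
      convexHull_mono (by exact_mod_cast hpt) (Finset.mem_convexHull'.2 ⟨p.2, h3⟩)⟩
  · exact absurd (dif_neg hp) h

/-- By conformity of the mesh, a hat function vanishes on the simplices without its node. -/
theorem hat_eq_zero {t : Finset (E d)} (ht : t ∈ T.faces) {z x : E d} (hz : z ∉ t)
    (hx : x ∈ convexHull ℝ (t : Set (E d))) : T.hat z x = 0 := by
  classical
  by_contra hne
  obtain ⟨q, hq, hzq, hxq⟩ := exists_cell_of_hat_ne_zero hne
  have hqf := (mem_cells.1 hq).1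
  have hx' : x ∈ convexHull ℝ ((t ∩ q : Finset (E d)) : Set (E d)) := by
    rw [Finset.coe_inter]
    exact T.inter_subset_convexHull ht hqf ⟨hx, hxq⟩
  obtain ⟨v, hv0, hv1, hv2⟩ := Finset.mem_convexHull'.1 hx'
  set w : E d → ℝ := fun y => if y ∈ t ∩ q then v y else 0 with hw
  have hw1 : ∀ y ∈ t ∩ q, w y = v y := fun y hy => if_pos hy
  have hw0 : ∀ y, y ∉ t ∩ q → w y = 0 := fun y hy => if_neg hy
  have hwb : IsBarycentric q w x := by
    refine ⟨fun y _ => ?_, ?_, ?_⟩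
    · by_cases hy : y ∈ t ∩ q
      · rw [hw1 y hy]; exact hv0 y hy
      · rw [hw0 y hy]
    · rw [← hv1, ← Finset.sum_subset Finset.inter_subset_right (fun y _ hy => hw0 y hy)]
      exact Finset.sum_congr rfl hw1
    · rw [← hv2, ← Finset.sum_subset Finset.inter_subset_right
        (fun y _ hy => by rw [hw0 y hy, zero_smul])]
      exact Finset.sum_congr rfl fun y hy => by rw [hw1 y hy]
  refine hne ?_
  rw [T.hat_eq hqf hzq hwb]
  exact hw0 z fun h => hz (Finset.mem_inter.1 h).1

theorem hat_mem_Icc (z x : E d) : T.hat z x ∈ Set.Icc (0 : ℝ) 1 := by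
  by_cases h : T.hat z x = 0
  · simp [h]
  obtain ⟨t, ht, hz, hx⟩ := exists_cell_of_hat_ne_zero h
  obtain ⟨L, hL⟩ := exists_coord ht
  rw [hat_eq_coord ht hL hz hx]
  exact ⟨hL.nonneg x hx z hz, hL.le_one hx hz⟩

/-- At most `d + 1` hat functions are nonzero at a given point. -/
theorem exists_support_hat (T : Triangulation d Ω) (x : E d) :
    ∃ t : Finset (E d), t.card ≤ d + 1 ∧ ∀ z ∉ t, T.hat z x = 0 := by
  by_cases h : ∃ z, T.hat z x ≠ 0
  · obtain ⟨z, hz⟩ := h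
    obtain ⟨t, ht, -, hx⟩ := exists_cell_of_hat_ne_zero hz
    exact ⟨t, (mem_cells.1 ht).2.le, fun y hy => hat_eq_zero (mem_cells.1 ht).1 hy hx⟩
  · push Not at h
    exact ⟨∅, by simp, fun z _ => h z⟩

theorem isCompact_cell (t : Finset (E d)) : IsCompact (convexHull ℝ (t : Set (E d))) :=
  t.finite_toSet.isCompact_convexHull ℝ

theorem measurable_hat (T : Triangulation d Ω) (z : E d) : Measurable (T.hat z) := by
  classical
  choose! L hL using fun t (ht : t ∈ T.cells) => exists_coord ht
  intro S hS
  have hm : ∀ t : Finset (E d), MeasurableSet (convexHull ℝ (t : Set (E d))) := fun t =>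
    (isCompact_cell t).isClosed.measurableSet
  have : T.hat z ⁻¹' S =
      (⋃ t ∈ T.cells.filter (z ∈ ·), convexHull ℝ (t : Set (E d)) ∩ L t z ⁻¹' S) ∪
      ((⋂ t ∈ T.cells.filter (z ∈ ·), (convexHull ℝ (t : Set (E d)))ᶜ) ∩ {_x | (0 : ℝ) ∈ S}) := by
    ext x
    simp only [Set.mem_preimage, Set.mem_union, Set.mem_iUnion, Set.mem_inter_iff, Set.mem_iInter,
      Finset.mem_filter, Set.mem_compl_iff, Set.mem_ofPred_eq, exists_prop]
    by_cases hx : ∃ t ∈ T.cells, z ∈ t ∧ x ∈ convexHull ℝ (t : Set (E d))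
    · obtain ⟨t, ht, hz, hx⟩ := hx
      constructor
      · intro h
        exact Or.inl ⟨t, ⟨ht, hz⟩, hx, by rwa [← hat_eq_coord ht (hL t ht) hz hx]⟩
      · rintro (⟨q, ⟨hq, hzq⟩, hxq, h⟩ | ⟨h, -⟩)
        · rwa [hat_eq_coord hq (hL q hq) hzq hxq]
        · exact absurd hx (h t ⟨ht, hz⟩)
    · have h0 : T.hat z x = 0 := by
        by_contra h
        exact hx (exists_cell_of_hat_ne_zero h)
      rw [h0]
      constructor
      · exact fun h => Or.inr ⟨fun t ht hxt => hx ⟨t, ht.1, ht.2, hxt⟩, h⟩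
      · rintro (⟨t, ⟨ht, hz⟩, hxt, -⟩ | ⟨-, h⟩)
        · exact absurd ⟨t, ht, hz, hxt⟩ hx
        · exact h
  rw [this]
  refine MeasurableSet.union ?_ (MeasurableSet.inter ?_ (MeasurableSet.const _))
  · exact Finset.measurableSet_biUnion _ fun t _ =>
      (hm t).inter ((IsCoordSystem.continuous z).measurable hS)
  · exact Finset.measurableSet_biInter _ fun t _ => (hm t).compl

/-- Distinct elements have disjoint interiors: their intersection lies in the hull of fewer than
`d + 1` points. -/
theorem disjoint_interior_cells {t q : Finset (E d)} (ht : t ∈ T.cells) (hq : q ∈ T.cells)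
    (hne : t ≠ q) : Disjoint (interior (convexHull ℝ (t : Set (E d))))
      (interior (convexHull ℝ (q : Set (E d)))) := by
  classical
  rw [Set.disjoint_iff_inter_eq_empty, ← Set.not_nonempty_iff_eq_empty]
  rintro hnon
  have hsub : interior (convexHull ℝ (t : Set (E d))) ∩ interior (convexHull ℝ (q : Set (E d))) ⊆
      interior (convexHull ℝ ((t ∩ q : Finset (E d)) : Set (E d))) := by
    rw [← interior_inter, Finset.coe_inter]
    exact interior_mono (T.inter_subset_convexHull (mem_cells.1 ht).1 (mem_cells.1 hq).1)
  have htop := interior_convexHull_nonempty_iff_affineSpan_eq_top.1 (hnon.mono hsub)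
  have hind : AffineIndependent ℝ ((↑) : (t ∩ q : Finset (E d)) → E d) :=
    (T.indep (mem_cells.1 ht).1).mono (by simp)
  have hr : Set.range ((↑) : (t ∩ q : Finset (E d)) → E d) = ((t ∩ q : Finset (E d)) : Set (E d)) :=
    Subtype.range_coe
  rw [← hr, hind.affineSpan_eq_top_iff_card_eq_finrank_add_one] at htop
  have hcard : (t ∩ q).card = d + 1 := by simpa using htop
  have h1 : t ∩ q = t := Finset.eq_of_subset_of_card_le Finset.inter_subset_left
    (by rw [hcard, (mem_cells.1 ht).2])
  have h2 : t ∩ q = q := Finset.eq_of_subset_of_card_le Finset.inter_subset_right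
    (by rw [hcard, (mem_cells.1 hq).2])
  exact hne (h1.symm.trans h2)

theorem exists_cell_of_mem_closure {x : E d} (hx : x ∈ closure Ω) :
    ∃ t ∈ T.cells, x ∈ convexHull ℝ (t : Set (E d)) := by
  rw [← T.space_eq, Geometry.SimplicialComplex.mem_space_iff] at hx
  obtain ⟨p, hp, hx⟩ := hx
  obtain ⟨t, ht, hpt, hc⟩ := T.pure p hp
  exact ⟨t, mem_cells.2 ⟨ht, hc⟩, convexHull_mono (by exact_mod_cast hpt) hx⟩

theorem cell_subset_closure {t : Finset (E d)} (ht : t ∈ T.cells) :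
    convexHull ℝ (t : Set (E d)) ⊆ closure Ω := by
  rw [← T.space_eq]
  exact T.convexHull_subset_space (mem_cells.1 ht).1

theorem interior_cell_subset (hΩ : interior (closure Ω) = Ω) {t : Finset (E d)}
    (ht : t ∈ T.cells) : interior (convexHull ℝ (t : Set (E d))) ⊆ Ω := by
  conv_rhs => rw [← hΩ]
  exact interior_mono (cell_subset_closure ht)

/-- The open star of a node `z` in the open set `Ω` is open. Indeed the elements near `z` all have
`z` as a vertex, so a contraction towards `z` reduces the claim to the barycentric coordinate of
`z` on these elements. -/
theorem isOpen_hat_pos (hΩ : interior (closure Ω) = Ω) {z : E d} (hzv : z ∈ T.vertices)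
    (hz : z ∈ Ω) : IsOpen {x | 0 < T.hat z x} := by
  classical
  choose! L hL using fun t (ht : t ∈ T.cells) => exists_coord ht
  have hopen : IsOpen Ω := hΩ ▸ isOpen_interior
  -- `V` is a neighbourhood of `z` covered by the elements at `z`.
  set V : Set (E d) := Ω ∩ ⋂ t ∈ T.cells.filter (z ∉ ·), (convexHull ℝ (t : Set (E d)))ᶜ with hV
  have hVo : IsOpen V := hopen.inter
    (isOpen_biInter_finset fun t _ => (isCompact_cell t).isClosed.isOpen_compl)
  have hzV : z ∈ V := by
    refine ⟨hz, ?_⟩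
    simp only [Set.mem_iInter, Finset.mem_filter, Set.mem_compl_iff]
    rintro t ⟨ht, hzt⟩ hzt'
    exact hzt ((T.vertex_mem_convexHull_iff hzv (mem_cells.1 ht).1).1 hzt')
  have hVcell : ∀ y ∈ V, ∃ t ∈ T.cells, z ∈ t ∧ y ∈ convexHull ℝ (t : Set (E d)) := by
    rintro y ⟨hy1, hy2⟩
    obtain ⟨t, ht, hyt⟩ := exists_cell_of_mem_closure (T := T) (subset_closure hy1)
    refine ⟨t, ht, ?_, hyt⟩
    by_contra hzt
    simp only [Set.mem_iInter, Finset.mem_filter, Set.mem_compl_iff] at hy2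
    exact hy2 t ⟨ht, hzt⟩ hyt
  rw [isOpen_iff_mem_nhds]
  intro x hx
  have hx : 0 < T.hat z x := hx
  set m : ℝ → E d → E d := fun ε y => AffineMap.lineMap z y ε with hm
  have hmc : ∀ ε, Continuous (m ε) := fun ε => by
    simp only [hm, AffineMap.lineMap_apply]; fun_prop
  obtain ⟨ε, hε, hε1⟩ : ∃ ε : ℝ, m ε x ∈ V ∧ ε ∈ Set.Ioc (0 : ℝ) 1 := by
    have hc : Continuous fun ε : ℝ => m ε x := by simp only [hm]; exact AffineMap.lineMap_continuous
    have h0 : (fun ε : ℝ => m ε x) 0 ∈ V := by simpa [hm] using hzV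
    have h1 : ∀ᶠ ε in nhdsWithin (0 : ℝ) (Set.Ioi 0), m ε x ∈ V :=
      (hc.continuousAt.eventually (hVo.mem_nhds h0)).filter_mono nhdsWithin_le_nhds
    exact (h1.and (Ioc_mem_nhdsGT zero_lt_one)).exists
  obtain ⟨hε0, hε1⟩ := hε1
  have hcoord : ∀ t ∈ T.cells, z ∈ t → ∀ u ∈ t, ∀ y,
      L t u (m ε y) = (1 - ε) * (if u = z then 1 else 0) + ε * L t u y := by
    intro t ht hzt u hu y
    simp only [hm]
    rw [AffineMap.apply_lineMap, AffineMap.lineMap_apply_ring',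
      (hL t ht).apply_self (T.indep (mem_cells.1 ht).1) hu hzt]
    ring
  -- On each element at `z` containing the contraction of `x`, the affine coordinate of `z` is
  -- positive at `x` itself, whether or not `x` lies in the element.
  have hxcell : ∀ t ∈ T.cells, z ∈ t → m ε x ∈ convexHull ℝ (t : Set (E d)) → 0 < L t z x := by
    intro t ht hzt hxt
    obtain ⟨q, hq, hzq, hxq⟩ := exists_cell_of_hat_ne_zero hx.ne'
    have hmq : m ε x ∈ convexHull ℝ (q : Set (E d)) :=
      (convex_convexHull ℝ _).lineMap_mem (subset_convexHull ℝ _ hzq) hxq ⟨hε0.le, hε1⟩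
    have h1 := hat_eq_coord ht (hL t ht) hzt hxt
    rw [hat_eq_coord hq (hL q hq) hzq hmq, hcoord q hq hzq z hzq, hcoord t ht hzt z hzt,
      ← hat_eq_coord hq (hL q hq) hzq hxq] at h1
    have h2 : T.hat z x = L t z x := by
      have : ε * T.hat z x = ε * L t z x := by linarith
      exact mul_left_cancel₀ hε0.ne' this
    rwa [← h2]
  have hnear : ∀ t ∈ T.cells.filter (z ∈ ·), ∀ᶠ y in nhds x,
      m ε y ∈ convexHull ℝ (t : Set (E d)) → 0 < L t z y := by
    intro t ht
    obtain ⟨ht, hzt⟩ := Finset.mem_filter.1 ht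
    by_cases hxt : m ε x ∈ convexHull ℝ (t : Set (E d))
    · have := (IsCoordSystem.continuous (L := L t) z).continuousAt.eventually
        (lt_mem_nhds (hxcell t ht hzt hxt))
      exact this.mono fun y hy _ => hy
    · have := (hmc ε).continuousAt.eventually
        ((isCompact_cell t).isClosed.isOpen_compl.mem_nhds hxt)
      exact this.mono fun y hy h => absurd h hy
  filter_upwards [(Filter.eventually_all_finset _).2 hnear,
    (hmc ε).continuousAt.eventually (hVo.mem_nhds hε)] with y hy hyV
  obtain ⟨t, ht, hzt, hyt⟩ := hVcell _ hyV
  have hpos := hy t (Finset.mem_filter.2 ⟨ht, hzt⟩) hyt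
  have hyK : y ∈ convexHull ℝ (t : Set (E d)) := by
    rw [(hL t ht).mem_convexHull_iff]
    intro u hu
    by_cases huz : u = z
    · rw [huz]; exact hpos.le
    · have := (hL t ht).nonneg _ hyt u hu
      rw [hcoord t ht hzt u hu, if_neg huz, mul_zero, zero_add] at this
      exact nonneg_of_mul_nonneg_right this hε0
  show 0 < T.hat z y
  rwa [hat_eq_coord ht (hL t ht) hzt hyK]

theorem hat_eq_zero_of_notMem (hΩ : interior (closure Ω) = Ω) {z : E d} (hzv : z ∈ T.vertices)
    (hz : z ∈ Ω) {x : E d} (hx : x ∉ Ω) : T.hat z x = 0 := by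
  by_contra hne
  have hpos : 0 < T.hat z x := lt_of_le_of_ne (hat_mem_Icc z x).1 (Ne.symm hne)
  refine hx ?_
  rw [← hΩ]
  refine (interior_maximal ?_ (isOpen_hat_pos hΩ hzv hz)) hpos
  intro y hy
  obtain ⟨t, ht, -, hyt⟩ := exists_cell_of_hat_ne_zero (ne_of_gt hy)
  exact cell_subset_closure ht hyt

/-- The hat function of a node in `Ω` is Lipschitz on the whole space. -/
theorem abs_hat_sub_le (hΩ : interior (closure Ω) = Ω) {r : ℝ} (hr : 0 < r)
    (hball : ∀ t ∈ T.cells, ∃ c, Metric.closedBall c r ⊆ convexHull ℝ (t : Set (E d))) {z : E d}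
    (hzv : z ∈ T.vertices) (hz : z ∈ Ω) (x y : E d) :
    |T.hat z x - T.hat z y| ≤ 1 / (2 * r) * ‖x - y‖ := by
  classical
  refine abs_sub_le_of_closed_cover (κ := Option {t // t ∈ T.cells.filter (z ∈ ·)})
    (fun k => k.elim {x | 0 < T.hat z x}ᶜ fun t => convexHull ℝ (t.1 : Set (E d)))
    ?_ ?_ (by positivity) ?_ x y
  · rintro (_ | t)
    · exact (isOpen_hat_pos hΩ hzv hz).isClosed_compl
    · exact (isCompact_cell _).isClosed
  · intro x
    by_cases hx : 0 < T.hat z x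
    · obtain ⟨t, ht, hzt, hxt⟩ := exists_cell_of_hat_ne_zero hx.ne'
      exact ⟨some ⟨t, Finset.mem_filter.2 ⟨ht, hzt⟩⟩, hxt⟩
    · exact ⟨none, hx⟩
  · rintro (_ | ⟨t, ht⟩) x hx y hy
    · have h0 : ∀ u : E d, u ∈ {x | 0 < T.hat z x}ᶜ → T.hat z u = 0 := fun u hu =>
        le_antisymm (not_lt.1 hu) (hat_mem_Icc z u).1
      rw [h0 x hx, h0 y hy, sub_zero, abs_zero]
      positivity
    · obtain ⟨ht, hzt⟩ := Finset.mem_filter.1 ht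
      obtain ⟨L, hL⟩ := exists_coord ht
      obtain ⟨c, hc⟩ := hball t ht
      rw [hat_eq_coord ht hL hzt hx, hat_eq_coord ht hL hzt hy]
      exact hL.abs_sub_le hr hc hzt x y

end Triangulation

/-! ### Interaction energies of hat functions -/

theorem volume_closedBall {d : ℕ} (z : E d) {h : ℝ} (hh : 0 < h) :
    volume (Metric.closedBall z h) =
      ENNReal.ofReal (h ^ d * volume.real (Metric.closedBall (0 : E d) 1)) := by
  rw [Measure.addHaar_closedBall' _ _ hh.le, ENNReal.ofReal_mul (by positivity),
    ofReal_measureReal (measure_closedBall_lt_top).ne]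
  simp

theorem volume_real_unit_closedBall_pos (d : ℕ) :
    0 < volume.real (Metric.closedBall (0 : E d) 1) := by
  rw [measureReal_def]
  exact ENNReal.toReal_pos (Metric.measure_closedBall_pos _ _ one_pos).ne'
    (measure_closedBall_lt_top).ne

namespace Triangulation

variable {Ω : Set (E d)} {T : Triangulation d Ω}

theorem mem_closedBall_of_hat_ne_zero {h : ℝ}
    (hdiam : ∀ t ∈ T.cells, Metric.diam (convexHull ℝ (t : Set (E d))) ≤ h) {z x : E d}
    (hx : T.hat z x ≠ 0) : x ∈ Metric.closedBall z h := by
  obtain ⟨t, ht, hz, hxt⟩ := exists_cell_of_hat_ne_zero hx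
  exact (Metric.dist_le_diam_of_mem (isCompact_cell t).isBounded hxt
    (subset_convexHull ℝ _ hz)).trans (hdiam t ht)

theorem mem_of_mem_dofs (hs : 1 / 2 ≤ s) {z : E d}
    (hz : z ∈ T.dofs s) : z ∈ Ω := by
  by_contra hzΩ
  refine hz.2 hs ⟨?_, fun h => hzΩ (interior_subset h)⟩
  rw [← T.space_eq]
  exact T.convexHull_subset_space hz.1 (subset_convexHull ℝ _ (by simp))

/-- The elements at a node fill at most a ball of radius `h`, since their interiors are
disjoint. -/
theorem sum_volume_star_le {h : ℝ}
    (hdiam : ∀ t ∈ T.cells, Metric.diam (convexHull ℝ (t : Set (E d))) ≤ h) (z : E d)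
    [DecidablePred fun t : Finset (E d) => z ∈ t] :
    ∑ t ∈ T.cells.filter (z ∈ ·), volume (convexHull ℝ (t : Set (E d))) ≤
      volume (Metric.closedBall z h) := by
  have h1 : ∀ t : Finset (E d), volume (convexHull ℝ (t : Set (E d))) =
      volume (interior (convexHull ℝ (t : Set (E d)))) := fun t =>
    (measure_interior_of_null_frontier ((convex_convexHull ℝ _).addHaar_frontier _)).symm
  simp_rw [h1]
  rw [← measure_biUnion_finset]
  · refine measure_mono ?_
    simp only [Set.iUnion_subset_iff, Finset.mem_filter]
    rintro t ⟨ht, hz⟩ x hx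
    exact (Metric.dist_le_diam_of_mem (isCompact_cell t).isBounded (interior_subset hx)
      (subset_convexHull ℝ _ hz)).trans (hdiam t ht)
  · intro t ht q hq hne
    exact disjoint_interior_cells (Finset.mem_filter.1 ht).1 (Finset.mem_filter.1 hq).1 hne
  · exact fun t _ => isOpen_interior.measurableSet

/-- The interaction energies of a hat function are dominated by a measurable function of total
mass `O(h^{d-2s})`. -/
theorem exists_energy_majorant (hd : 1 ≤ d) (hs₀ : 0 < s) (hs₁ : s < 1) {ρ : ℝ} (hρ : 0 < ρ) :
    ∃ C : ℝ, 0 < C ∧ ∀ {Ω : Set (E d)}, interior (closure Ω) = Ω → ∀ (T : Triangulation d Ω)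
      {h : ℝ}, 0 < h →
      (∀ t ∈ T.cells, ∃ c, Metric.closedBall c (ρ * h) ⊆ convexHull ℝ (t : Set (E d))) →
      (∀ t ∈ T.cells, Metric.diam (convexHull ℝ (t : Set (E d))) ≤ h) →
      ∀ z ∈ T.dofs s, ∃ W : E d → E d → ℝ≥0∞, Measurable (Function.uncurry W) ∧
        (∀ x y, T.hat z x ≠ 0 → ENNReal.ofReal
          ((T.hat z x - T.hat z y) ^ 2 * (1 / ‖x - y‖ ^ ((d : ℝ) + 2 * s))) ≤ W x y) ∧
        (∀ x y, y ∉ Ω → ENNReal.ofReal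
          (T.hat z x ^ 2 * (1 / ‖x - y‖ ^ ((d : ℝ) + 2 * s))) ≤ W x y) ∧
        ∫⁻ x, ∫⁻ y, W x y ≤ ENNReal.ofReal (C * (h ^ d * h ^ (-(2 * s)))) := by
  classical
  set ω : ℝ := volume.real (Metric.closedBall (0 : E d) 1) with hω
  have hωpos : 0 < ω := volume_real_unit_closedBall_pos d
  rcases le_or_gt (1 / 2) s with hs | hs
  · obtain ⟨J, hJ, hJle⟩ := exists_lintegral_dampedKernel_le (d := d) (p := 2) hd hs₀
      (by push_cast; linarith)
    -- The slope `1 / (2 ρ h)` of the hat function fixes the range of the damped kernel.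
    refine ⟨ω * (J * (2 * ρ) ^ (-(2 * s))), by positivity, ?_⟩
    intro Ω hΩ T h hh hball hdiam z hz
    have hzΩ := mem_of_mem_dofs hs hz
    have hr : 0 < ρ * h := by positivity
    set g : E d → ℝ≥0∞ := fun w => ENNReal.ofReal (dampedKernel d s 2 (2 * (ρ * h)) w) with hg
    have hgm : Measurable g := (measurable_dampedKernel _).ennreal_ofReal
    have hBm : MeasurableSet (Metric.closedBall z h) := Metric.isClosed_closedBall.measurableSet
    have hmain : ∀ x y, T.hat z x ≠ 0 → ENNReal.ofReal
          ((T.hat z x - T.hat z y) ^ 2 * (1 / ‖x - y‖ ^ ((d : ℝ) + 2 * s))) ≤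
        (Metric.closedBall z h).indicator 1 x * g (x - y) := by
      intro x y hx
      rw [Set.indicator_of_mem (mem_closedBall_of_hat_ne_zero hdiam hx), Pi.one_apply, one_mul, hg]
      refine ENNReal.ofReal_le_ofReal ?_
      rw [dampedKernel, mul_one_div]
      gcongr
      have hx1 := T.hat_mem_Icc z x
      have hy1 := T.hat_mem_Icc z y
      refine le_min ?_ ?_
      · rw [sq_le_one_iff_abs_le_one, abs_le]
        constructor <;> linarith [hx1.1, hx1.2, hy1.1, hy1.2]
      · rw [← sq_abs]
        gcongr
        rw [div_eq_inv_mul, ← one_div]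
        exact abs_hat_sub_le hΩ hr hball hz.1 hzΩ x y
    refine ⟨fun x y => (Metric.closedBall z h).indicator 1 x * g (x - y), ?_, hmain, ?_, ?_⟩
    · exact ((measurable_one.indicator hBm).comp measurable_fst).mul
        (hgm.comp (measurable_fst.sub measurable_snd))
    · intro x y hy
      by_cases hx : T.hat z x = 0
      · simp [hx]
      · have := hmain x y hx
        rwa [hat_eq_zero_of_notMem hΩ hz.1 hzΩ hy, sub_zero] at this
    · rw [lintegral_indicator_mul_sub g hgm hBm, volume_closedBall z hh]
      refine (mul_le_mul_right (hJle _ (by positivity)) _).trans ?_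
      rw [← ENNReal.ofReal_mul (by positivity), ← mul_assoc 2 ρ h,
        Real.mul_rpow (by positivity) hh.le]
      exact ENNReal.ofReal_le_ofReal (le_of_eq (by ring))
  · obtain ⟨J, hJ, hJle⟩ := exists_lintegral_dampedKernel_le (d := d) (p := 1) hd hs₀
      (by push_cast; linarith)
    refine ⟨ω * (J * (2 * ρ) ^ (-(2 * s)) + J * (ρ / (2 * d)) ^ (-(2 * s))), by positivity, ?_⟩
    intro Ω hΩ T h hh hball hdiam z hz
    have hr : 0 < ρ * h := by positivity
    set g : E d → ℝ≥0∞ := fun w => ENNReal.ofReal (dampedKernel d s 1 (2 * (ρ * h)) w) with hg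
    have hgm : Measurable g := (measurable_dampedKernel _).ennreal_ofReal
    set K : Finset (E d) → Set (E d) := fun t => convexHull ℝ (t : Set (E d)) with hK
    have hKm : ∀ t, MeasurableSet (K t) := fun t => (isCompact_cell t).isClosed.measurableSet
    have hUm : ∀ t, MeasurableSet (interior (K t))ᶜ := fun t => isOpen_interior.measurableSet.compl
    have hKi : ∀ t, Measurable ((K t).indicator (1 : E d → ℝ≥0∞)) := fun t =>
      measurable_one.indicator (hKm t)
    have hUi : ∀ t, Measurable ((interior (K t))ᶜ.indicator (1 : E d → ℝ≥0∞)) := fun t =>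
      measurable_one.indicator (hUm t)
    set k : E d → ℝ≥0∞ := fun w => ENNReal.ofReal (1 / ‖w‖ ^ ((d : ℝ) + 2 * s)) with hk
    have hkm : Measurable k := by rw [hk]; fun_prop
    -- `W₁` accounts for pairs of points in the same element, `W₂` for all other pairs.
    set W₁ : Finset (E d) → E d → E d → ℝ≥0∞ := fun t x y => (K t).indicator 1 x * g (x - y)
      with hW₁
    set W₂ : Finset (E d) → E d → E d → ℝ≥0∞ := fun t x y =>
      (K t).indicator 1 x * (interior (K t))ᶜ.indicator 1 y * k (x - y) with hW₂
    have hW₁m : ∀ t, Measurable (Function.uncurry (W₁ t)) := fun t =>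
      ((hKi t).comp measurable_fst).mul (hgm.comp (measurable_fst.sub measurable_snd))
    have hW₂m : ∀ t, Measurable (Function.uncurry (W₂ t)) := fun t =>
      (((hKi t).comp measurable_fst).mul ((hUi t).comp measurable_snd)).mul
        (hkm.comp (measurable_fst.sub measurable_snd))
    have hout : ∀ t ∈ T.cells.filter (z ∈ ·), ∀ x ∈ K t, ∀ y ∉ interior (K t), ∀ c : ℝ, c ^ 2 ≤ 1 →
        ENNReal.ofReal (c ^ 2 * (1 / ‖x - y‖ ^ ((d : ℝ) + 2 * s))) ≤
        ∑ t ∈ T.cells.filter (z ∈ ·), (W₁ t x y + W₂ t x y) := by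
      intro t ht x hx y hy c hc
      refine le_trans ?_ (Finset.single_le_sum (fun _ _ => zero_le) ht)
      refine le_trans ?_ le_add_self
      simp only [hW₂]
      rw [Set.indicator_of_mem hx, Set.indicator_of_mem (Set.mem_compl hy), Pi.one_apply,
        Pi.one_apply, one_mul, one_mul, hk]
      exact ENNReal.ofReal_le_ofReal (mul_le_of_le_one_left (by positivity) hc)
    refine ⟨fun x y => ∑ t ∈ T.cells.filter (z ∈ ·), (W₁ t x y + W₂ t x y), ?_, ?_, ?_, ?_⟩
    · have : (Function.uncurry fun x y => ∑ t ∈ T.cells.filter (z ∈ ·), (W₁ t x y + W₂ t x y)) =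
          fun q => ∑ t ∈ T.cells.filter (z ∈ ·),
            (Function.uncurry (W₁ t) q + Function.uncurry (W₂ t) q) := rfl
      rw [this]
      exact Finset.measurable_sum _ fun t _ => (hW₁m t).add (hW₂m t)
    · intro x y hx
      obtain ⟨t, ht, hzt, hxt⟩ := exists_cell_of_hat_ne_zero hx
      have htf : t ∈ T.cells.filter (z ∈ ·) := Finset.mem_filter.2 ⟨ht, hzt⟩
      have hx1 := T.hat_mem_Icc z x
      have hy1 := T.hat_mem_Icc z y
      have habs : |T.hat z x - T.hat z y| ≤ 1 := by
        rw [abs_le]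
        constructor <;> linarith [hx1.1, hx1.2, hy1.1, hy1.2]
      have hsq : (T.hat z x - T.hat z y) ^ 2 ≤ 1 := (sq_le_one_iff_abs_le_one _).2 habs
      by_cases hy : y ∈ interior (K t)
      · refine le_trans ?_ (Finset.single_le_sum (fun _ _ => zero_le) htf)
        refine le_trans ?_ le_self_add
        simp only [hW₁]
        rw [Set.indicator_of_mem hxt, Pi.one_apply, one_mul, hg]
        refine ENNReal.ofReal_le_ofReal ?_
        rw [dampedKernel, mul_one_div]
        gcongr
        refine le_min hsq ?_
        rw [← sq_abs]
        refine (pow_le_of_le_one (abs_nonneg _) habs two_ne_zero).trans ?_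
        rw [pow_one, div_eq_inv_mul, ← one_div]
        obtain ⟨L, hL⟩ := exists_coord ht
        obtain ⟨c, hc⟩ := hball t ht
        rw [hat_eq_coord ht hL hzt hxt, hat_eq_coord ht hL hzt (interior_subset hy)]
        exact hL.abs_sub_le hr hc hzt x y
      · exact hout t htf x hxt y hy _ hsq
    · intro x y hy
      by_cases hx : T.hat z x = 0
      · simp [hx]
      obtain ⟨t, ht, hzt, hxt⟩ := exists_cell_of_hat_ne_zero hx
      have hx1 := T.hat_mem_Icc z x
      exact hout t (Finset.mem_filter.2 ⟨ht, hzt⟩) x hxt y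
        (fun h => hy (interior_cell_subset hΩ ht h)) _ (pow_le_one₀ hx1.1 hx1.2)
    · have h1 : ∀ x, ∫⁻ y, ∑ t ∈ T.cells.filter (z ∈ ·), (W₁ t x y + W₂ t x y) =
          ∑ t ∈ T.cells.filter (z ∈ ·), ((∫⁻ y, W₁ t x y) + ∫⁻ y, W₂ t x y) := by
        intro x
        rw [lintegral_finsetSum]
        · refine Finset.sum_congr rfl fun t _ => ?_
          exact lintegral_add_left (f := W₁ t x) ((hW₁m t).comp measurable_prodMk_left) _
        · exact fun t _ => ((hW₁m t).comp measurable_prodMk_left).add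
            ((hW₂m t).comp measurable_prodMk_left)
      have hm1 : ∀ t, Measurable fun x => ∫⁻ y, W₁ t x y := fun t => (hW₁m t).lintegral_prod_right'
      have hm2 : ∀ t, Measurable fun x => ∫⁻ y, W₂ t x y := fun t => (hW₂m t).lintegral_prod_right'
      have hm12 : ∀ t, Measurable fun x => (∫⁻ y, W₁ t x y) + ∫⁻ y, W₂ t x y := fun t =>
        (hm1 t).add (hm2 t)
      simp_rw [h1]
      rw [lintegral_finsetSum _ fun t _ => hm12 t]
      have h2 : ∀ t ∈ T.cells.filter (z ∈ ·), ∫⁻ x, ((∫⁻ y, W₁ t x y) + ∫⁻ y, W₂ t x y) ≤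
          volume (K t) * ENNReal.ofReal
            (J * (2 * (ρ * h)) ^ (-(2 * s)) + J * (ρ * h / (2 * d)) ^ (-(2 * s))) := by
        intro t ht
        obtain ⟨c, hc⟩ := hball t (Finset.mem_filter.1 ht).1
        rw [lintegral_add_left (hm1 t), ENNReal.ofReal_add (by positivity) (by positivity), mul_add]
        refine add_le_add ?_ ?_
        · rw [lintegral_indicator_mul_sub g hgm (hKm t)]
          exact mul_le_mul_right (hJle _ (by positivity)) _
        · refine (lintegral_perimeter_le (convex_convexHull ℝ _) (hKm t)
            (isCompact_cell t).measure_lt_top.ne hr hd hs₀ hc).trans ?_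
          exact mul_le_mul_right (hJle _ (by positivity)) _
      refine (Finset.sum_le_sum h2).trans ?_
      rw [← Finset.sum_mul]
      have hstar := (sum_volume_star_le hdiam z).trans (volume_closedBall z hh).le
      refine (mul_le_mul_left hstar _).trans ?_
      rw [← ENNReal.ofReal_mul (by positivity), ← mul_assoc 2 ρ h,
        Real.mul_rpow (by positivity) hh.le, mul_div_right_comm ρ h,
        Real.mul_rpow (by positivity) hh.le]
      exact ENNReal.ofReal_le_ofReal (le_of_eq (by ring))

end Triangulation

/-! ### Gram matrices of functions with bounded overlap -/

section Gram

open Matrix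

theorem sq_sum_mul_eq {X n : Type*} [Fintype n] {q : X → ℝ} {a : n → X → ℝ} (v : n → ℝ)
    (x : X) :
    (∑ i, v i * a i x) ^ 2 * q x = ∑ i, ∑ j, v i * v j * (a i x * a j x * q x) := by
  rw [sq, Finset.sum_mul_sum, Finset.sum_mul]
  refine Finset.sum_congr rfl fun i _ => ?_
  rw [Finset.sum_mul]
  exact Finset.sum_congr rfl fun j _ => by ring

variable {X n : Type*} [MeasurableSpace X]

/-- The Gram matrix of the functions `a i` with respect to the weight `q`. -/
def gram (μ : Measure X) (q : X → ℝ) (a : n → X → ℝ) : Matrix n n ℝ :=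
  Matrix.of fun i j => ∫ x, a i x * a j x * q x ∂μ

variable {μ : Measure X} {q : X → ℝ} {a : n → X → ℝ}

theorem integrable_mul_mul (hq : ∀ x, 0 ≤ q x) (hqm : Measurable q) (ha : ∀ i, Measurable (a i))
    (hint : ∀ i, Integrable (fun x => a i x ^ 2 * q x) μ) (i j : n) :
    Integrable (fun x => a i x * a j x * q x) μ := by
  refine ((hint i).add (hint j)).mono' (((ha i).mul (ha j)).mul hqm).aestronglyMeasurable ?_
  filter_upwards with x
  rw [Real.norm_eq_abs, abs_mul, abs_of_nonneg (hq x), Pi.add_apply, ← add_mul]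
  refine mul_le_mul_of_nonneg_right ?_ (hq x)
  rw [abs_le]
  constructor <;> nlinarith [sq_nonneg (a i x + a j x), sq_nonneg (a i x - a j x),
    sq_nonneg (a i x), sq_nonneg (a j x)]

variable [Fintype n]

theorem integrable_sq_sum_mul (hq : ∀ x, 0 ≤ q x) (hqm : Measurable q)
    (ha : ∀ i, Measurable (a i)) (hint : ∀ i, Integrable (fun x => a i x ^ 2 * q x) μ)
    (v : n → ℝ) : Integrable (fun x => (∑ i, v i * a i x) ^ 2 * q x) μ := by
  simp_rw [sq_sum_mul_eq]
  exact integrable_finsetSum _ fun i _ => integrable_finsetSum _ fun j _ =>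
    (integrable_mul_mul hq hqm ha hint i j).const_mul _

theorem dotProduct_gram_mulVec (hq : ∀ x, 0 ≤ q x) (hqm : Measurable q)
    (ha : ∀ i, Measurable (a i)) (hint : ∀ i, Integrable (fun x => a i x ^ 2 * q x) μ)
    (v : n → ℝ) : v ⬝ᵥ gram μ q a *ᵥ v = ∫ x, (∑ i, v i * a i x) ^ 2 * q x ∂μ := by
  have hi := integrable_mul_mul hq hqm ha hint
  simp_rw [sq_sum_mul_eq]
  rw [integral_finsetSum _ fun i _ => integrable_finsetSum _ fun j _ => (hi i j).const_mul _]
  simp only [dotProduct, mulVec]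
  refine Finset.sum_congr rfl fun i _ => ?_
  rw [integral_finsetSum _ fun j _ => (hi i j).const_mul _, Finset.mul_sum]
  refine Finset.sum_congr rfl fun j _ => ?_
  rw [integral_const_mul, gram, Matrix.of_apply]
  ring

theorem dotProduct_gram_nonneg (hq : ∀ x, 0 ≤ q x) (hqm : Measurable q)
    (ha : ∀ i, Measurable (a i)) (hint : ∀ i, Integrable (fun x => a i x ^ 2 * q x) μ)
    (v : n → ℝ) : 0 ≤ v ⬝ᵥ gram μ q a *ᵥ v := by
  rw [dotProduct_gram_mulVec hq hqm ha hint]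
  exact integral_nonneg fun x => mul_nonneg (sq_nonneg _) (hq x)

theorem sq_sum_le_of_support {N : ℕ} {b : n → ℝ} {S : Finset n} (hS : S.card ≤ N)
    (hb : ∀ i ∉ S, b i = 0) : (∑ i, b i) ^ 2 ≤ N * ∑ i, b i ^ 2 := by
  have h1 : ∑ i, b i = ∑ i ∈ S, b i :=
    (Finset.sum_subset (Finset.subset_univ _) fun i _ hi => hb i hi).symm
  have h2 : ∑ i, b i ^ 2 = ∑ i ∈ S, b i ^ 2 :=
    (Finset.sum_subset (Finset.subset_univ _) fun i _ hi => by rw [hb i hi]; ring).symm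
  rw [h1, h2]
  refine sq_sum_le_card_mul_sum_sq.trans ?_
  have : (S.card : ℝ) ≤ N := by exact_mod_cast hS
  gcongr

/-- If at most `N` of the functions are nonzero at each point, then the Gram matrix is bounded by
`N` times its diagonal. -/
theorem dotProduct_gram_le (hq : ∀ x, 0 ≤ q x) (hqm : Measurable q)
    (ha : ∀ i, Measurable (a i)) (hint : ∀ i, Integrable (fun x => a i x ^ 2 * q x) μ) {N : ℕ}
    (hN : ∀ x, ∃ S : Finset n, S.card ≤ N ∧ ∀ i ∉ S, a i x = 0) {D : ℝ}
    (hD : ∀ i, ∫ x, a i x ^ 2 * q x ∂μ ≤ D) (v : n → ℝ) :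
    v ⬝ᵥ gram μ q a *ᵥ v ≤ N * D * (v ⬝ᵥ v) := by
  rw [dotProduct_gram_mulVec hq hqm ha hint]
  have hR : Integrable (fun x => N * ∑ i, v i ^ 2 * (a i x ^ 2 * q x)) μ :=
    (integrable_finsetSum _ fun i _ => (hint i).const_mul _).const_mul _
  refine (integral_mono (integrable_sq_sum_mul hq hqm ha hint v) hR fun x => ?_).trans ?_
  · obtain ⟨S, hS, hS0⟩ := hN x
    have h1 := sq_sum_le_of_support (b := fun i => v i * a i x) hS
      fun i hi => by rw [hS0 i hi, mul_zero]
    refine (mul_le_mul_of_nonneg_right h1 (hq x)).trans (le_of_eq ?_)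
    rw [mul_assoc, Finset.sum_mul]
    congr 1
    exact Finset.sum_congr rfl fun i _ => by ring
  · rw [integral_const_mul, integral_finsetSum _ fun i _ => (hint i).const_mul _, mul_assoc]
    refine mul_le_mul_of_nonneg_left ?_ (Nat.cast_nonneg N)
    rw [dotProduct, Finset.mul_sum]
    refine Finset.sum_le_sum fun i _ => ?_
    rw [integral_const_mul]
    nlinarith [hD i, sq_nonneg (v i)]

theorem integrable_and_integral_le {f : X → ℝ} (hf : ∀ x, 0 ≤ f x) (hfm : Measurable f) {D : ℝ}
    (hD0 : 0 ≤ D) (hD : ∫⁻ x, ENNReal.ofReal (f x) ∂μ ≤ ENNReal.ofReal D) :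
    Integrable f μ ∧ ∫ x, f x ∂μ ≤ D := by
  have hint : Integrable f μ := by
    refine ⟨hfm.aestronglyMeasurable, ?_⟩
    rw [hasFiniteIntegral_iff_ofReal (Filter.Eventually.of_forall hf)]
    exact hD.trans_lt ENNReal.ofReal_lt_top
  refine ⟨hint, ?_⟩
  rwa [← ofReal_integral_eq_lintegral_ofReal hint (Filter.Eventually.of_forall hf),
    ENNReal.ofReal_le_ofReal_iff hD0] at hD

end Gram

/-! ### Eigenvalue bounds for the stiffness matrix -/

theorem fracConst_pos {d : ℕ} {s : ℝ} (hs₀ : 0 < s) (hs₁ : s < 1) : 0 < fracConst d s := by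
  have h1 : 0 < Real.Gamma (s + d / 2) := Real.Gamma_pos_of_pos (by positivity)
  have h2 : 0 < Real.Gamma (1 - s) := Real.Gamma_pos_of_pos (by linarith)
  unfold fracConst
  positivity

namespace Triangulation

open Matrix

variable {Ω : Set (E d)}

theorem exists_support_dofs (T : Triangulation d Ω) (x : E d) :
    ∃ S : Finset (T.dofs s), S.card ≤ d + 1 ∧ ∀ i ∉ S, T.hat i x = 0 := by
  classical
  obtain ⟨t, ht, h⟩ := T.exists_support_hat x
  refine ⟨t.subtype (· ∈ T.dofs s), ?_, fun i hi => h _ fun hit => hi (Finset.mem_subtype.2 hit)⟩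
  rw [Finset.card_subtype]
  exact (Finset.card_filter_le _ _).trans ht

theorem exists_support_dofs_sub (T : Triangulation d Ω) (x y : E d) :
    ∃ S : Finset (T.dofs s), S.card ≤ 2 * (d + 1) ∧ ∀ i ∉ S, T.hat i x - T.hat i y = 0 := by
  classical
  obtain ⟨S, hS, hS0⟩ := T.exists_support_dofs (s := s) x
  obtain ⟨R, hR, hR0⟩ := T.exists_support_dofs (s := s) y
  refine ⟨S ∪ R, (Finset.card_union_le _ _).trans (by omega), fun i hi => ?_⟩
  rw [Finset.mem_union, not_or] at hi
  rw [hS0 i hi.1, hR0 i hi.2, sub_zero]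

/-- The stiffness matrix as a combination of two Gram matrices on product spaces. The equality
needs both energies of the hat functions to be finite, so that the iterated integrals are integrals
over the products. -/
theorem stiffnessMatrix_eq (T : Triangulation d Ω)
    (h₁ : ∀ i : T.dofs s, Integrable (fun p : E d × E d => (T.hat i p.1 - T.hat i p.2) ^ 2 *
      (1 / ‖p.1 - p.2‖ ^ ((d : ℝ) + 2 * s))) ((volume.restrict Ω).prod (volume.restrict Ω)))
    (h₂ : ∀ i : T.dofs s, Integrable (fun p : E d × E d => T.hat i p.1 ^ 2 *
      (1 / ‖p.1 - p.2‖ ^ ((d : ℝ) + 2 * s))) ((volume.restrict Ω).prod (volume.restrict Ωᶜ))) :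
    stiffnessMatrix T s =
      (fracConst d s / 2) • gram ((volume.restrict Ω).prod (volume.restrict Ω))
        (fun p => 1 / ‖p.1 - p.2‖ ^ ((d : ℝ) + 2 * s))
        (fun (i : T.dofs s) p => T.hat i p.1 - T.hat i p.2) +
      fracConst d s • gram ((volume.restrict Ω).prod (volume.restrict Ωᶜ))
        (fun p => 1 / ‖p.1 - p.2‖ ^ ((d : ℝ) + 2 * s))
        (fun (i : T.dofs s) p => T.hat i p.1) := by
  have hq : ∀ p : E d × E d, 0 ≤ 1 / ‖p.1 - p.2‖ ^ ((d : ℝ) + 2 * s) := fun p => by positivity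
  have hqm : Measurable fun p : E d × E d => 1 / ‖p.1 - p.2‖ ^ ((d : ℝ) + 2 * s) := by fun_prop
  have hm1 : ∀ i : T.dofs s, Measurable fun p : E d × E d => T.hat i p.1 := fun i =>
    (T.measurable_hat i).comp measurable_fst
  have hm2 : ∀ i : T.dofs s, Measurable fun p : E d × E d => T.hat i p.2 := fun i =>
    (T.measurable_hat i).comp measurable_snd
  ext i j
  have e1 := integrable_mul_mul (a := fun (i : T.dofs s) (p : E d × E d) =>
    T.hat i p.1 - T.hat i p.2) hq hqm (fun i => (hm1 i).sub (hm2 i)) h₁ i j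
  have e2 := integrable_mul_mul hq hqm hm1 h₂ i j
  simp only [stiffnessMatrix, fracForm, gram, Matrix.add_apply, Matrix.smul_apply,
    Matrix.of_apply, smul_eq_mul]
  rw [integral_prod _ e1, integral_prod _ e2]
  simp only [mul_one_div]

theorem stiffnessMatrix_isSymm (T : Triangulation d Ω) : (stiffnessMatrix T s).IsSymm := by
  ext i j
  simp only [stiffnessMatrix, fracForm, Matrix.transpose_apply, Matrix.of_apply]
  simp_rw [mul_comm (T.hat j _ - _), mul_comm (T.hat j _)]

theorem massMatrix_isSymm (T : Triangulation d Ω) : (massMatrix T s).IsSymm := by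
  ext i j
  simp only [massMatrix, Matrix.transpose_apply, Matrix.of_apply]
  simp_rw [mul_comm (T.hat j _)]

/-- The stiffness matrix is positive semidefinite with largest eigenvalue `O(h^{d-2s})`. -/
theorem exists_stiffness_bounds (hd : 1 ≤ d) (hs₀ : 0 < s) (hs₁ : s < 1) {ρ : ℝ} (hρ : 0 < ρ) :
    ∃ C : ℝ, 0 < C ∧ ∀ {Ω : Set (E d)}, interior (closure Ω) = Ω → ∀ (T : Triangulation d Ω)
      {h : ℝ}, 0 < h →
      (∀ t ∈ T.cells, ∃ c, Metric.closedBall c (ρ * h) ⊆ convexHull ℝ (t : Set (E d))) →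
      (∀ t ∈ T.cells, Metric.diam (convexHull ℝ (t : Set (E d))) ≤ h) →
      ∀ v : T.dofs s → ℝ, 0 ≤ v ⬝ᵥ stiffnessMatrix T s *ᵥ v ∧
        v ⬝ᵥ stiffnessMatrix T s *ᵥ v ≤ C * (h ^ d * h ^ (-(2 * s))) * (v ⬝ᵥ v) := by
  obtain ⟨C, hC, hW⟩ := exists_energy_majorant (s := s) hd hs₀ hs₁ hρ
  have hc := fracConst_pos (d := d) hs₀ hs₁
  refine ⟨3 * fracConst d s * (d + 1) * C, by positivity, ?_⟩
  intro Ω hΩ T h hh hball hdiam v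
  set D : ℝ := C * (h ^ d * h ^ (-(2 * s))) with hD
  have hD0 : 0 ≤ D := by positivity
  have hΩo : IsOpen Ω := hΩ ▸ isOpen_interior
  have hq : ∀ p : E d × E d, 0 ≤ 1 / ‖p.1 - p.2‖ ^ ((d : ℝ) + 2 * s) := fun p => by positivity
  have hqm : Measurable fun p : E d × E d => 1 / ‖p.1 - p.2‖ ^ ((d : ℝ) + 2 * s) := by fun_prop
  have hm1 : ∀ i : T.dofs s, Measurable fun p : E d × E d => T.hat i p.1 := fun i =>
    (T.measurable_hat i).comp measurable_fst
  have hm2 : ∀ i : T.dofs s, Measurable fun p : E d × E d => T.hat i p.1 - T.hat i p.2 := fun i =>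
    (hm1 i).sub ((T.measurable_hat i).comp measurable_snd)
  have hE₁ : ∀ i : T.dofs s, Integrable (fun p : E d × E d => (T.hat i p.1 - T.hat i p.2) ^ 2 *
      (1 / ‖p.1 - p.2‖ ^ ((d : ℝ) + 2 * s))) ((volume.restrict Ω).prod (volume.restrict Ω)) ∧
      ∫ p : E d × E d, (T.hat i p.1 - T.hat i p.2) ^ 2 * (1 / ‖p.1 - p.2‖ ^ ((d : ℝ) + 2 * s))
        ∂(volume.restrict Ω).prod (volume.restrict Ω) ≤ 2 * D := by
    intro i
    have hm : Measurable fun p : E d × E d => (T.hat i p.1 - T.hat i p.2) ^ 2 *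
      (1 / ‖p.1 - p.2‖ ^ ((d : ℝ) + 2 * s)) := ((hm2 i).pow_const 2).mul hqm
    refine integrable_and_integral_le (fun p => mul_nonneg (sq_nonneg _) (hq p)) hm
      (by positivity) ?_
    obtain ⟨W, hWm, hW1, -, hWD⟩ := hW hΩ T hh hball hdiam i i.2
    rw [lintegral_prod _ hm.ennreal_ofReal.aemeasurable]
    have hsymm : ∀ x y, ENNReal.ofReal
        ((T.hat i x - T.hat i y) ^ 2 * (1 / ‖x - y‖ ^ ((d : ℝ) + 2 * s))) ≤ W x y + W y x := by
      intro x y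
      by_cases hx : T.hat i x = 0
      · by_cases hy : T.hat i y = 0
        · simp [hx, hy]
        · refine le_trans (le_of_eq ?_) ((hW1 y x hy).trans le_add_self)
          rw [norm_sub_rev, sub_sq_comm]
      · exact (hW1 x y hx).trans le_self_add
    calc ∫⁻ x in Ω, ∫⁻ y in Ω, ENNReal.ofReal
          ((T.hat i x - T.hat i y) ^ 2 * (1 / ‖x - y‖ ^ ((d : ℝ) + 2 * s)))
        ≤ ∫⁻ x, ∫⁻ y, (W x y + W y x) :=
          (lintegral_mono fun x => (setLIntegral_le_lintegral _ _).trans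
            (lintegral_mono fun y => hsymm x y)).trans (setLIntegral_le_lintegral _ _)
      _ = ∫⁻ x, ((∫⁻ y, W x y) + ∫⁻ y, W y x) := lintegral_congr fun x =>
          lintegral_add_left (f := W x) (hWm.comp measurable_prodMk_left) _
      _ = (∫⁻ x, ∫⁻ y, W x y) + ∫⁻ x, ∫⁻ y, W y x := lintegral_add_left hWm.lintegral_prod_right' _
      _ = (∫⁻ x, ∫⁻ y, W x y) + ∫⁻ x, ∫⁻ y, W x y := by
          rw [lintegral_lintegral_swap (f := fun x y => W y x)
            (hWm.comp measurable_swap).aemeasurable]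
      _ ≤ ENNReal.ofReal D + ENNReal.ofReal D := add_le_add hWD hWD
      _ = ENNReal.ofReal (2 * D) := by rw [← ENNReal.ofReal_add hD0 hD0, two_mul]
  have hE₂ : ∀ i : T.dofs s, Integrable (fun p : E d × E d => T.hat i p.1 ^ 2 *
      (1 / ‖p.1 - p.2‖ ^ ((d : ℝ) + 2 * s))) ((volume.restrict Ω).prod (volume.restrict Ωᶜ)) ∧
      ∫ p : E d × E d, T.hat i p.1 ^ 2 * (1 / ‖p.1 - p.2‖ ^ ((d : ℝ) + 2 * s))
        ∂(volume.restrict Ω).prod (volume.restrict Ωᶜ) ≤ D := by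
    intro i
    have hm : Measurable fun p : E d × E d => T.hat i p.1 ^ 2 *
      (1 / ‖p.1 - p.2‖ ^ ((d : ℝ) + 2 * s)) := ((hm1 i).pow_const 2).mul hqm
    refine integrable_and_integral_le (fun p => mul_nonneg (sq_nonneg _) (hq p)) hm
      (by positivity) ?_
    obtain ⟨W, hWm, -, hW2, hWD⟩ := hW hΩ T hh hball hdiam i i.2
    rw [lintegral_prod _ hm.ennreal_ofReal.aemeasurable]
    refine le_trans ?_ hWD
    refine (lintegral_mono fun x => ?_).trans (setLIntegral_le_lintegral _ _)
    refine le_trans ?_ (setLIntegral_le_lintegral Ωᶜ _)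
    exact setLIntegral_mono' hΩo.measurableSet.compl fun y hy => hW2 x y hy
  rw [stiffnessMatrix_eq T (fun i => (hE₁ i).1) (fun i => (hE₂ i).1)]
  simp only [Matrix.add_mulVec, Matrix.smul_mulVec, dotProduct_add, dotProduct_smul, smul_eq_mul]
  constructor
  · have n1 := dotProduct_gram_nonneg hq hqm hm2 (fun i => (hE₁ i).1) v
    have n2 := dotProduct_gram_nonneg hq hqm hm1 (fun i => (hE₂ i).1) v
    positivity
  · have u1 := dotProduct_gram_le hq hqm hm2 (fun i => (hE₁ i).1)
      (fun p => T.exists_support_dofs_sub p.1 p.2) (fun i => (hE₁ i).2) v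
    have u2 := dotProduct_gram_le hq hqm hm1 (fun i => (hE₂ i).1)
      (fun p => T.exists_support_dofs p.1) (fun i => (hE₂ i).2) v
    push_cast at u1 u2
    have u1' := mul_le_mul_of_nonneg_left u1 (by positivity : 0 ≤ fracConst d s / 2)
    have u2' := mul_le_mul_of_nonneg_left u2 hc.le
    refine (add_le_add u1' u2').trans (le_of_eq ?_)
    rw [mul_assoc _ C, ← hD]
    ring

end Triangulation

/-! ### Eigenvalue bounds for the mass matrix -/

namespace Triangulation

open Matrix

variable {Ω : Set (E d)}

open scoped Classical in
/-- The nodal values of a finite element function, extended by zero to all points. -/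
def nodal (T : Triangulation d Ω) (v : T.dofs s → ℝ) (z : E d) : ℝ :=
  if h : z ∈ T.dofs s then v ⟨z, h⟩ else 0

variable {T : Triangulation d Ω}

theorem nodal_coe (v : T.dofs s → ℝ) (i : T.dofs s) : T.nodal v i = v i := by
  simp [nodal]

theorem sum_mul_hat_eq (v : T.dofs s → ℝ) {t : Finset (E d)} (ht : t ∈ T.cells)
    {L : E d → E d →ᵃ[ℝ] ℝ} (hL : IsCoordSystem t L) {x : E d}
    (hx : x ∈ convexHull ℝ (t : Set (E d))) :
    ∑ i : T.dofs s, v i * T.hat i x = ∑ z ∈ t, T.nodal v z * L z x := by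
  classical
  set f : E d → ℝ := fun z => T.nodal v z * T.hat z x with hf
  have h1 : ∑ i : T.dofs s, v i * T.hat i x = ∑ z ∈ (T.finite_dofs s).toFinset, f z := by
    rw [Finset.sum_subtype (p := (· ∈ T.dofs s)) _ (fun z => by simp) f]
    exact Finset.sum_congr rfl fun i _ => by rw [hf]; simp only [nodal_coe]
  have h2 : ∀ z, z ∉ (T.finite_dofs s).toFinset → f z = 0 := fun z hz => by
    simp only [Set.Finite.mem_toFinset] at hz
    simp [hf, nodal, hz]
  have h3 : ∀ z, z ∉ t → f z = 0 := fun z hz => by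
    simp only [hf]
    rw [hat_eq_zero (mem_cells.1 ht).1 hz hx, mul_zero]
  rw [h1, Finset.sum_subset (Finset.subset_union_left (s₂ := t)) fun z _ hz => h2 z hz,
    ← Finset.sum_subset (Finset.subset_union_right (s₁ := (T.finite_dofs s).toFinset))
      fun z _ hz => h3 z hz]
  exact Finset.sum_congr rfl fun z hz => by simp only [hf]; rw [hat_eq_coord ht hL hz hx]

/-- On an element shrunk by the factor `1/4` towards the node with the largest value, a finite
element function is at least half as large as this value. -/
theorem nodal_sq_le (v : T.dofs s → ℝ) {t : Finset (E d)} (ht : t ∈ T.cells) {m : E d}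
    (hm : m ∈ t) (hmax : ∀ z ∈ t, |T.nodal v z| ≤ |T.nodal v m|) {y : E d}
    (hy : y ∈ convexHull ℝ (t : Set (E d)))
    (hy' : AffineMap.homothety m (1 / 4 : ℝ) y ∈ convexHull ℝ (t : Set (E d))) :
    T.nodal v m ^ 2 / 4 ≤
      (∑ i : T.dofs s, v i * T.hat i (AffineMap.homothety m (1 / 4 : ℝ) y)) ^ 2 := by
  classical
  obtain ⟨L, hL⟩ := exists_coord ht
  rw [sum_mul_hat_eq v ht hL hy']
  have hco : ∀ z ∈ t, L z (AffineMap.homothety m (1 / 4 : ℝ) y) =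
      3 / 4 * (if z = m then 1 else 0) + 1 / 4 * L z y := by
    intro z hz
    rw [AffineMap.homothety_eq_lineMap, AffineMap.apply_lineMap, AffineMap.lineMap_apply_ring',
      hL.apply_self (T.indep (mem_cells.1 ht).1) hz hm]
    ring
  have hsum : ∑ z ∈ t, T.nodal v z * L z (AffineMap.homothety m (1 / 4 : ℝ) y) =
      3 / 4 * T.nodal v m + 1 / 4 * ∑ z ∈ t, T.nodal v z * L z y := by
    rw [Finset.mul_sum, Finset.sum_congr rfl fun z hz => by rw [hco z hz, mul_add],
      Finset.sum_add_distrib]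
    congr 1
    · simp [hm, mul_comm]
    · exact Finset.sum_congr rfl fun z _ => by ring
  have hle : |∑ z ∈ t, T.nodal v z * L z y| ≤ |T.nodal v m| := by
    refine (Finset.abs_sum_le_sum_abs _ _).trans ?_
    have : ∑ z ∈ t, |T.nodal v z * L z y| ≤ ∑ z ∈ t, |T.nodal v m| * L z y := by
      refine Finset.sum_le_sum fun z hz => ?_
      rw [abs_mul, abs_of_nonneg (hL.nonneg y hy z hz)]
      exact mul_le_mul_of_nonneg_right (hmax z hz) (hL.nonneg y hy z hz)
    rwa [← Finset.mul_sum, hL.sum_eq, mul_one] at this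
  rw [hsum]
  set S := ∑ z ∈ t, T.nodal v z * L z y
  have habs : |T.nodal v m| / 2 ≤ |3 / 4 * T.nodal v m + 1 / 4 * S| := by
    have h1 := abs_sub_abs_le_abs_sub (3 / 4 * T.nodal v m) (-(1 / 4 * S))
    rw [abs_neg, abs_mul, abs_mul, sub_neg_eq_add] at h1
    norm_num at h1
    linarith
  calc T.nodal v m ^ 2 / 4 = (|T.nodal v m| / 2) ^ 2 := by rw [div_pow, sq_abs]; norm_num
    _ ≤ |3 / 4 * T.nodal v m + 1 / 4 * S| ^ 2 := by gcongr
    _ = _ := sq_abs _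

/-- On a single element, the mass of a finite element function controls its nodal values. -/
theorem sum_nodal_sq_le (v : T.dofs s → ℝ) {t : Finset (E d)} (ht : t ∈ T.cells) {c : E d} {r : ℝ}
    (hr : 0 < r) (hball : Metric.closedBall c r ⊆ convexHull ℝ (t : Set (E d)))
    (hint : IntegrableOn (fun x => (∑ i : T.dofs s, v i * T.hat i x) ^ 2)
      (interior (convexHull ℝ (t : Set (E d))))) :
    ((d + 1) * 4 ^ (d + 1) : ℝ)⁻¹ * (r ^ d * volume.real (Metric.closedBall (0 : E d) 1)) *
        ∑ z ∈ t, T.nodal v z ^ 2 ≤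
      ∫ x in interior (convexHull ℝ (t : Set (E d))), (∑ i : T.dofs s, v i * T.hat i x) ^ 2 := by
  have htne : t.Nonempty := by
    rw [← Finset.card_pos, (mem_cells.1 ht).2]; omega
  obtain ⟨m, hm, hmax⟩ := t.exists_max_image (fun z => |T.nodal v z|) htne
  set U := interior (convexHull ℝ (t : Set (E d))) with hU
  set S := AffineMap.homothety m (1 / 4 : ℝ) '' U with hS
  have hconv := convex_convexHull ℝ (t : Set (E d))
  have hUfin : volume U ≠ ∞ :=
    ne_top_of_le_ne_top (isCompact_cell t).measure_lt_top.ne (measure_mono interior_subset)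
  have hSU : S ⊆ U := by
    rintro _ ⟨y, hy, rfl⟩
    have := hconv.combo_self_interior_mem_interior (subset_convexHull ℝ _ hm) hy
      (by norm_num : (0 : ℝ) ≤ 3 / 4) (by norm_num : (0 : ℝ) < 1 / 4) (by norm_num)
    convert this using 1
    rw [AffineMap.homothety_apply, vsub_eq_sub, vadd_eq_add]; module
  have hSm : MeasurableSet S :=
    (AffineMap.homothety_isOpenMap m (1 / 4 : ℝ) (by norm_num) _ isOpen_interior).measurableSet
  have hfr : Module.finrank ℝ (E d) = d := by simp
  have hSvol : volume.real S = (1 / 4) ^ d * volume.real U := by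
    rw [measureReal_def, hS, Measure.addHaar_image_homothety, hfr, ENNReal.toReal_mul,
      ENNReal.toReal_ofReal (abs_nonneg _), abs_of_nonneg (by positivity), measureReal_def]
  have hUvol : r ^ d * volume.real (Metric.closedBall (0 : E d) 1) ≤ volume.real U := by
    have h1 : volume (Metric.closedBall c r) ≤ volume U := (measure_mono hball).trans_eq
      (measure_interior_of_null_frontier (hconv.addHaar_frontier _)).symm
    rw [volume_closedBall c hr] at h1
    rw [measureReal_def volume U]
    exact (ENNReal.ofReal_le_iff_le_toReal hUfin).1 h1
  have hlow : T.nodal v m ^ 2 / 4 * volume.real S ≤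
      ∫ x in S, (∑ i : T.dofs s, v i * T.hat i x) ^ 2 := by
    refine setIntegral_ge_of_const_le_real hSm (ne_top_of_le_ne_top hUfin (measure_mono hSU)) ?_
      (hint.mono_set hSU)
    rintro _ ⟨y, hy, rfl⟩
    exact nodal_sq_le v ht hm hmax (interior_subset hy)
      (interior_subset (hSU (Set.mem_image_of_mem _ hy)))
  have hmono : ∫ x in S, (∑ i : T.dofs s, v i * T.hat i x) ^ 2 ≤
      ∫ x in U, (∑ i : T.dofs s, v i * T.hat i x) ^ 2 :=
    setIntegral_mono_set hint (Filter.Eventually.of_forall fun x => sq_nonneg _)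
      hSU.eventuallyLE
  refine le_trans ?_ (hlow.trans hmono)
  have hsum : ∑ z ∈ t, T.nodal v z ^ 2 ≤ (d + 1) * T.nodal v m ^ 2 := by
    have := Finset.sum_le_card_nsmul t (fun z => T.nodal v z ^ 2) (T.nodal v m ^ 2)
      fun z hz => sq_le_sq.2 (hmax z hz)
    rw [(mem_cells.1 ht).2, nsmul_eq_mul] at this
    exact_mod_cast this
  rw [hSvol]
  calc _ ≤ ((d + 1) * 4 ^ (d + 1) : ℝ)⁻¹ * volume.real U * ((d + 1) * T.nodal v m ^ 2) := by
        gcongr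
    _ = T.nodal v m ^ 2 / 4 * ((1 / 4) ^ d * volume.real U) := by
        rw [one_div, inv_pow, pow_succ]
        field_simp

theorem dotProduct_self_le_sum (v : T.dofs s → ℝ) :
    v ⬝ᵥ v ≤ ∑ t ∈ T.cells, ∑ z ∈ t, T.nodal v z ^ 2 := by
  classical
  set D := (T.finite_dofs s).toFinset with hD
  have h1 : v ⬝ᵥ v = ∑ z ∈ D, T.nodal v z ^ 2 := by
    rw [Finset.sum_subtype (p := (· ∈ T.dofs s)) _ (fun z => by simp [hD]), dotProduct]
    exact Finset.sum_congr rfl fun i _ => by rw [nodal_coe, sq]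
  have h2 : ∀ z ∈ D, T.nodal v z ^ 2 ≤ ∑ t ∈ T.cells, if z ∈ t then T.nodal v z ^ 2 else 0 := by
    intro z hz
    have hz' : z ∈ T.dofs s := by simpa [hD] using hz
    obtain ⟨t, ht, hzt, hc⟩ := T.pure {z} hz'.1
    have hmem : z ∈ t := hzt (Finset.mem_singleton_self z)
    refine le_trans ?_ (Finset.single_le_sum (f := fun t : Finset (E d) =>
      if z ∈ t then T.nodal v z ^ 2 else 0) (fun t _ => ?_) (mem_cells.2 ⟨ht, hc⟩))
    · simp [hmem]
    · split_ifs <;> positivity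
  rw [h1]
  refine (Finset.sum_le_sum h2).trans ?_
  rw [Finset.sum_comm]
  refine Finset.sum_le_sum fun t _ => ?_
  rw [← Finset.sum_filter]
  exact Finset.sum_le_sum_of_subset_of_nonneg (fun z hz => (Finset.mem_filter.1 hz).2)
    fun z _ _ => sq_nonneg _

/-- The eigenvalues of the mass matrix are comparable to `h^d`. -/
theorem exists_mass_bounds (d : ℕ) (s : ℝ) {ρ : ℝ} (hρ : 0 < ρ) :
    ∃ c C : ℝ, 0 < c ∧ 0 < C ∧ ∀ {Ω : Set (E d)}, interior (closure Ω) = Ω →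
      ∀ (T : Triangulation d Ω) {h : ℝ}, 0 < h →
      (∀ t ∈ T.cells, ∃ c, Metric.closedBall c (ρ * h) ⊆ convexHull ℝ (t : Set (E d))) →
      (∀ t ∈ T.cells, Metric.diam (convexHull ℝ (t : Set (E d))) ≤ h) →
      ∀ v : T.dofs s → ℝ, c * h ^ d * (v ⬝ᵥ v) ≤ v ⬝ᵥ massMatrix T s *ᵥ v ∧
        v ⬝ᵥ massMatrix T s *ᵥ v ≤ C * h ^ d * (v ⬝ᵥ v) := by
  set ω : ℝ := volume.real (Metric.closedBall (0 : E d) 1) with hω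
  have hωpos : 0 < ω := volume_real_unit_closedBall_pos d
  refine ⟨((d + 1) * 4 ^ (d + 1) : ℝ)⁻¹ * (ρ ^ d * ω), (d + 1) * ω, by positivity,
    by positivity, ?_⟩
  intro Ω hΩ T h hh hball hdiam v
  have hΩo : IsOpen Ω := hΩ ▸ isOpen_interior
  have hM : massMatrix T s =
      gram (volume.restrict Ω) (fun _ => 1) (fun i : T.dofs s => T.hat i) := by
    ext i j
    simp [massMatrix, gram]
  have hE : ∀ i : T.dofs s, Integrable (fun x => T.hat i x ^ 2 * 1) (volume.restrict Ω) ∧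
      ∫ x in Ω, T.hat i x ^ 2 * 1 ≤ h ^ d * ω := by
    intro i
    refine integrable_and_integral_le (fun x => by positivity)
      (((T.measurable_hat i).pow_const 2).mul_const 1) (by positivity) ?_
    rw [← volume_closedBall (i : E d) hh,
      ← lintegral_indicator_one Metric.isClosed_closedBall.measurableSet]
    refine (setLIntegral_le_lintegral _ _).trans (lintegral_mono fun x => ?_)
    by_cases hx : T.hat i x = 0
    · simp [hx]
    · have h1 := T.hat_mem_Icc i x
      rw [Set.indicator_of_mem (mem_closedBall_of_hat_ne_zero hdiam hx), Pi.one_apply,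
        ENNReal.ofReal_le_one, mul_one]
      exact pow_le_one₀ h1.1 h1.2
  have h01 : ∀ _x : E d, (0 : ℝ) ≤ 1 := fun _ => zero_le_one
  have hmeas : ∀ i : T.dofs s, Measurable (T.hat i) := fun i => T.measurable_hat i
  have hint := integrable_sq_sum_mul h01 measurable_const hmeas (fun i => (hE i).1) v
  rw [hM]
  constructor
  · rw [dotProduct_gram_mulVec h01 measurable_const hmeas (fun i => (hE i).1)]
    simp only [mul_one] at hint ⊢
    have hint' : ∀ t ∈ T.cells, IntegrableOn (fun x => (∑ i : T.dofs s, v i * T.hat i x) ^ 2)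
        (interior (convexHull ℝ (t : Set (E d)))) := fun t ht =>
      IntegrableOn.mono_set hint (interior_cell_subset hΩ ht)
    have hunion : ∫ x in ⋃ t ∈ T.cells, interior (convexHull ℝ (t : Set (E d))),
        (∑ i : T.dofs s, v i * T.hat i x) ^ 2 ≤
        ∫ x in Ω, (∑ i : T.dofs s, v i * T.hat i x) ^ 2 := by
      refine setIntegral_mono_set hint (Filter.Eventually.of_forall fun x => sq_nonneg _) ?_
      have hsub : (⋃ t ∈ T.cells, interior (convexHull ℝ (t : Set (E d)))) ⊆ Ω :=
        Set.iUnion₂_subset fun t ht => interior_cell_subset hΩ ht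
      exact hsub.eventuallyLE
    rw [integral_biUnion_finset _ (fun t _ => isOpen_interior.measurableSet)
      (fun t ht q hq hne => disjoint_interior_cells ht hq hne) hint'] at hunion
    refine le_trans ?_ hunion
    have hlocal : ∀ t ∈ T.cells, ((d + 1) * 4 ^ (d + 1) : ℝ)⁻¹ * ((ρ * h) ^ d * ω) *
        ∑ z ∈ t, T.nodal v z ^ 2 ≤
        ∫ x in interior (convexHull ℝ (t : Set (E d))), (∑ i : T.dofs s, v i * T.hat i x) ^ 2 := by
      intro t ht
      obtain ⟨c, hc⟩ := hball t ht
      exact sum_nodal_sq_le v ht (by positivity) hc (hint' t ht)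
    refine le_trans ?_ (Finset.sum_le_sum hlocal)
    rw [← Finset.mul_sum]
    refine le_trans (le_of_eq ?_) (mul_le_mul_of_nonneg_left (dotProduct_self_le_sum v)
      (by positivity))
    rw [mul_pow]
    ring
  · refine (dotProduct_gram_le h01 measurable_const hmeas (fun i => (hE i).1)
      (fun x => T.exists_support_dofs x) (fun i => (hE i).2) v).trans (le_of_eq ?_)
    push_cast
    ring

theorem mem_elements_of_mem_cells {t : Finset (E d)} (ht : t ∈ T.cells) :
    convexHull ℝ (t : Set (E d)) ∈ T.elements :=
  ⟨t, (mem_cells.1 ht).1, (mem_cells.1 ht).2, rfl⟩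

theorem diam_le_meshSize {t : Finset (E d)} (ht : t ∈ T.cells) :
    Metric.diam (convexHull ℝ (t : Set (E d))) ≤ T.meshSize := by
  have hfin : T.elements.Finite := by
    refine (T.cells.finite_toSet.image
      fun t : Finset (E d) => convexHull ℝ (t : Set (E d))).subset ?_
    rintro _ ⟨t, ht, hc, rfl⟩
    exact ⟨t, mem_cells.2 ⟨ht, hc⟩, rfl⟩
  exact le_csSup (hfin.image _).bddAbove ⟨_, mem_elements_of_mem_cells ht, rfl⟩

end Triangulation

/-! ### Quasi-uniform families -/

/-- In a shape-regular and quasi-uniform family, all elements contain balls of radius comparable to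
the mesh size. -/
theorem exists_inscribed_balls {d : ℕ} (hd : 1 ≤ d) {Ω : Set (E d)} {ι : Type*}
    {P : ι → Triangulation d Ω} (hshape : ShapeRegular P) (hquasi : QuasiUniform P) :
    ∃ ρ : ℝ, 0 < ρ ∧ ∀ i, ∀ t ∈ (P i).cells, 0 < (P i).meshSize ∧
      ∃ c, Metric.closedBall c (ρ * (P i).meshSize) ⊆ convexHull ℝ (t : Set (E d)) := by
  obtain ⟨σ, hσ⟩ := hshape
  obtain ⟨c, hc, hquasi⟩ := hquasi
  have hne : Nontrivial (E d) := by
    have : Nonempty (Fin d) := ⟨⟨0, hd⟩⟩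
    infer_instance
  refine ⟨c / (2 * max σ 1), by positivity, fun i t ht => ?_⟩
  have hK := Triangulation.mem_elements_of_mem_cells ht
  obtain ⟨x, r, hr, hball, hdiam⟩ := hσ i _ hK
  have hpos : 0 < (P i).meshSize := by
    refine lt_of_lt_of_le ?_ (Triangulation.diam_le_meshSize ht)
    have h1 := Metric.diam_mono hball (Triangulation.isCompact_cell t).isBounded
    rw [Metric.diam_closedBall_eq x hr.le] at h1
    linarith
  refine ⟨hpos, x, (Metric.closedBall_subset_closedBall ?_).trans hball⟩
  rw [div_mul_eq_mul_div, div_le_iff₀ (by positivity)]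
  have h1 := (hquasi i _ hK).trans hdiam
  nlinarith [le_max_left σ 1]

end FracLap
end

theorem mainTheorem2 {d : ℕ} (hd : 1 ≤ d) {Ω : Set (FracLap.E d)}
    (hΩ : interior (closure Ω) = Ω) {s : ℝ} (hs₀ : 0 < s) (hs₁ : s < 1)
    {ι : Type*} (P : ι → FracLap.Triangulation d Ω)
    (hshape : FracLap.ShapeRegular P) (hquasi : FracLap.QuasiUniform P) :
    ∃ C : ℝ, 0 < C ∧ ∀ (i : ι) (Δt : ℝ), 0 < Δt → Δt ≤ 1 →
      FracLap.condNumber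
          (FracLap.massMatrix (P i) s + Δt • FracLap.stiffnessMatrix (P i) s) ≤
        ENNReal.ofReal (C * (1 + Δt / (P i).meshSize ^ (2 * s))) := by
  obtain ⟨ρ, hρ, hballs⟩ := FracLap.exists_inscribed_balls hd hshape hquasi
  obtain ⟨a, b, ha, hb, hmass⟩ := FracLap.Triangulation.exists_mass_bounds d s hρ
  obtain ⟨A, hA, hstiff⟩ := FracLap.Triangulation.exists_stiffness_bounds hd hs₀ hs₁ hρ
  refine ⟨(b + A) / a, by positivity, fun i Δt hΔ _ => ?_⟩
  set T := P i
  set h := T.meshSize with hh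
  have hsymm : (FracLap.massMatrix T s + Δt • FracLap.stiffnessMatrix T s).IsSymm :=
    T.massMatrix_isSymm.add (T.stiffnessMatrix_isSymm.smul Δt)
  by_cases hcells : T.cells.Nonempty
  · obtain ⟨t₀, ht₀⟩ := hcells
    have hpos : 0 < h := (hballs i t₀ ht₀).1
    have hball := fun t ht => (hballs i t ht).2
    have hdiam := fun t (ht : t ∈ T.cells) => FracLap.Triangulation.diam_le_meshSize ht
    have hquad : ∀ v : T.dofs s → ℝ,
        v ⬝ᵥ (FracLap.massMatrix T s + Δt • FracLap.stiffnessMatrix T s).mulVec v =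
        v ⬝ᵥ (FracLap.massMatrix T s).mulVec v +
          Δt * (v ⬝ᵥ (FracLap.stiffnessMatrix T s).mulVec v) := by
      intro v
      rw [Matrix.add_mulVec, Matrix.smul_mulVec, dotProduct_add, dotProduct_smul, smul_eq_mul]
    refine (FracLap.condNumber_le hsymm (a := a * h ^ d)
      (b := b * h ^ d + Δt * (A * (h ^ d * h ^ (-(2 * s))))) (by positivity) (by positivity)
      (fun v => ?_) (fun v => ?_)).trans (ENNReal.ofReal_le_ofReal ?_)
    · rw [hquad]
      have h1 := (hmass hΩ T hpos hball hdiam v).1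
      have h2 := mul_nonneg hΔ.le (hstiff hΩ T hpos hball hdiam v).1
      linarith
    · rw [hquad, add_mul, mul_assoc Δt]
      exact add_le_add (hmass hΩ T hpos hball hdiam v).2
        (mul_le_mul_of_nonneg_left (hstiff hΩ T hpos hball hdiam v).2 hΔ.le)
    · rw [Real.rpow_neg hpos.le]
      have hp : 0 < h ^ (2 * s) := Real.rpow_pos_of_pos hpos _
      have hpd : 0 < h ^ d := pow_pos hpos d
      rw [show (b * h ^ d + Δt * (A * (h ^ d * (h ^ (2 * s))⁻¹))) / (a * h ^ d) =
        (b + A * (Δt / h ^ (2 * s))) / a by field_simp, div_mul_eq_mul_div]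
      gcongr
      have : 0 ≤ Δt / h ^ (2 * s) := by positivity
      nlinarith
  -- A mesh without elements has no nodes, so the matrices are empty.
  · have hempty : IsEmpty (T.dofs s) := by
      refine ⟨fun z => hcells ?_⟩
      obtain ⟨t, ht, -, hc⟩ := T.pure _ z.2.1
      exact ⟨t, FracLap.Triangulation.mem_cells.2 ⟨ht, hc⟩⟩
    refine (FracLap.condNumber_le hsymm (a := 1) (b := 0) one_pos le_rfl (fun v => ?_)
      (fun v => ?_)).trans (by simp)
    · simp [dotProduct]
    · simp [dotProduct]
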